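/- Let $\mathbb K=\mathbb R$ or $\mathbb C$, let $n\ge 2$, let $E_1,\dots,E_n$ be Banach spaces over $\mathbb K$, and let $A\colon E_1\times\cdots\times E_n\to\mathbb K$ be a continuous $n$-linear form. Let $A_{n-1}\colon E_1\times\cdots\times E_{n-1}\to E_n'$ be the continuous $(n-1)$-linear mapping $A_{n-1}(x_1,\dots,x_{n-1})(x_n)=A(x_1,\dots,x_n)$, where $E_n'$ is the topological dual of $E_n$. For a finite family $(x_j)_{j=1}^m$ in a Banach space $E$ put $$\|(x_j)_j\|_{\ell_2^w(E)}=\sup_{\varphi\in B_{E'}}\Big(\sum_{j=1}^m|\varphi(x_j)|^2\Big)^{1/2},\qquad \|(x_j)_j\|_{\mathrm{Rad}(E)}=\Big(\int_0^1\Big\|\sum_{j=1}^m r_j(t)x_j\Big\|^2dt\Big)^{1/2},$$ where $r_j(t)=\operatorname{sign}(\sin 2^j\pi t)$ are the Rademacher functions. The form $A$ is absolutely $(1;2,\dots,2)$-summing if there is $C>0$ such that $\sum_{j=1}^m|A(x_j^1,\dots,x_j^n)|\le C\prod_{i=1}^n\|(x_j^i)_j\|_{\ell_2^w(E_i)}$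 for all $m$ and all finite families $(x_j^i)_{j=1}^m$ in $E_i$. A continuous $k$-linear mapping $B\colon E_1\times\cdots\times E_k\to F$ is almost summing if there is $C>0$ such that $\|(B(x_j^1,\dots,x_j^k))_j\|_{\mathrm{Rad}(F)}\le C\prod_{i=1}^k\|(x_j^i)_j\|_{\ell_2^w(E_i)}$ for all such finite families. A Banach space $E$ is a GT-space if every continuous linear operator $u\colon E\to\ell_2$ is absolutely $1$-summing, i.e. there is $C>0$ with $\sum_{j}\|u(x_j)\|\le C\sup_{\varphi\in B_{E'}}\sum_j|\varphi(x_j)|$ for all finite families in $E$; and $E$ has cotype $2$ if there is $C\ge 0$ with $(\sum_j\|x_j\|^2)^{1/2}\le C\|(x_j)_j\|_{\mathrm{Rad}(E)}$ for all finite families in $E$. Then: (i) If $A$ is absolutely $(1;2,\dots,2)$-summing, then $A_{n-1}$ is almost summing. (ii) If $E_n'$ is a GT-space of cotype $2$ and $A_{n-1}$ is almost summing, then $A$ is absolutely $(1;2,\dots,2)$-summing. -/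

import Mathlib

open MeasureTheory
open scoped NNReal ENNReal

namespace MultilinearSumming

noncomputable section

/-- The `ℓ_p`-norm of a family of vectors, with values in `[0, ∞]` (for real `p > 0`). -/
def ellNorm {ι F : Type*} [NormedAddCommGroup F] (p : ℝ) (x : ι → F) : ℝ≥0∞ :=
  (∑' j, ‖x j‖ₑ ^ p) ^ (1 / p)

/-- The weak `ℓ_p`-norm of a family of vectors: the supremum over the closed unit ball of the
topological dual of the `ℓ_p`-norms of the scalar families `(φ (x j))_j`. -/
def weakNorm (𝕜 : Type*) [RCLike 𝕜] {ι E : Type*} [NormedAddCommGroup E] [NormedSpace 𝕜 E]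
    (p : ℝ) (x : ι → E) : ℝ≥0∞ :=
  ⨆ φ : StrongDual 𝕜 E, ⨆ _ : ‖φ‖ ≤ 1, ellNorm p (fun j => φ (x j))

/-- The Rademacher function `r_j(t) = sign (sin (2 ^ j * π * t))`, for `j = 1, 2, …`. -/
def rademacher (j : ℕ) (t : ℝ) : ℝ := Real.sign (Real.sin (2 ^ j * Real.pi * t))

/-- The function `t ↦ ∑_j r_j(t) x_j` of a finite family; the `m` vectors, indexed by `Fin m`,
are paired with `r_1, …, r_m`. -/
def radSum (𝕜 : Type*) [RCLike 𝕜] {E : Type*} [NormedAddCommGroup E] [NormedSpace 𝕜 E]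
    {m : ℕ} (x : Fin m → E) (t : ℝ) : E :=
  ∑ j : Fin m, ((rademacher (j + 1) t : ℝ) : 𝕜) • x j

/-- The norm of a sequence in `Rad_p(E)`: the supremum over `n` of the `L^p([0,1], E)` norms of
the Rademacher sums of the first `n` terms. -/
def radNorm (𝕜 : Type*) [RCLike 𝕜] {E : Type*} [NormedAddCommGroup E] [NormedSpace 𝕜 E]
    (p : ℝ≥0∞) (x : ℕ → E) : ℝ≥0∞ :=
  ⨆ n : ℕ, eLpNorm (radSum 𝕜 (fun j : Fin n => x j)) p (volume.restrict (Set.Icc (0 : ℝ) 1))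

/-- A finite family regarded as a sequence, by adding zeros. -/
def extendZero {E : Type*} [Zero E] {m : ℕ} (x : Fin m → E) : ℕ → E :=
  fun j => if h : j < m then x ⟨j, h⟩ else 0

/-- Absolutely `(p; p_1, …, p_n)`-summing continuous multilinear mappings. -/
def IsAbsolutelySumming {𝕜 : Type*} [RCLike 𝕜] {n : ℕ} {E : Fin n → Type*} {F : Type*}
    [∀ i, NormedAddCommGroup (E i)] [∀ i, NormedSpace 𝕜 (E i)]
    [NormedAddCommGroup F] [NormedSpace 𝕜 F] (p : ℝ) (q : Fin n → ℝ)
    (A : ContinuousMultilinearMap 𝕜 E F) : Prop :=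
  ∃ C : ℝ≥0, 0 < C ∧ ∀ (m : ℕ) (x : (i : Fin n) → Fin m → E i),
    ellNorm p (fun j => A (fun i => x i j)) ≤ C * ∏ i, weakNorm 𝕜 (q i) (x i)

/-- Almost summing continuous multilinear mappings. -/
def IsAlmostSumming {𝕜 : Type*} [RCLike 𝕜] {n : ℕ} {E : Fin n → Type*} {F : Type*}
    [∀ i, NormedAddCommGroup (E i)] [∀ i, NormedSpace 𝕜 (E i)]
    [NormedAddCommGroup F] [NormedSpace 𝕜 F]
    (A : ContinuousMultilinearMap 𝕜 E F) : Prop :=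
  ∃ C : ℝ≥0, 0 < C ∧ ∀ (m : ℕ) (x : (i : Fin n) → Fin m → E i),
    radNorm 𝕜 2 (extendZero (fun j => A (fun i => x i j))) ≤ C * ∏ i, weakNorm 𝕜 2 (x i)

/-- Absolutely `p`-summing continuous linear operators. -/
def IsAbsolutelySummingOp {𝕜 : Type*} [RCLike 𝕜] {E F : Type*}
    [NormedAddCommGroup E] [NormedSpace 𝕜 E] [NormedAddCommGroup F] [NormedSpace 𝕜 F]
    (p : ℝ) (u : E →L[𝕜] F) : Prop :=
  ∃ C : ℝ≥0, 0 < C ∧ ∀ (m : ℕ) (x : Fin m → E),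
    ellNorm p (fun j => u (x j)) ≤ C * weakNorm 𝕜 p x

/-- `E` is a GT-space: every continuous linear operator from `E` to `ℓ_2` is absolutely
`1`-summing. -/
def IsGTSpace (𝕜 : Type*) [RCLike 𝕜] (E : Type*) [NormedAddCommGroup E] [NormedSpace 𝕜 E] :
    Prop :=
  ∀ u : E →L[𝕜] lp (fun _ : ℕ => 𝕜) 2, IsAbsolutelySummingOp 1 u

/-- `E` has (Rademacher) cotype `q`. -/
def HasCotype (𝕜 : Type*) [RCLike 𝕜] (E : Type*) [NormedAddCommGroup E] [NormedSpace 𝕜 E]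
    (q : ℝ) : Prop :=
  ∃ C : ℝ≥0, ∀ (m : ℕ) (x : Fin m → E),
    ellNorm q x ≤ C * eLpNorm (radSum 𝕜 x) 2 (volume.restrict (Set.Icc (0 : ℝ) 1))

end

end MultilinearSumming

/-!
The first implication is a duality argument. Let `y_j = A_{n-1}(x_j^1, …, x_j^{n-1})`, functionals
on `E_n`. A function `Z` on the space of signs, with values in `E_n`, which almost norms
`ε ↦ ∑ ε_j y_j` and satisfies `‖Z ε‖ ≤ ‖∑ ε_j y_j‖`, has Rademacher coefficients
`z_j` whose weak `ℓ_2`-norm is, by Bessel's inequality, at most the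
`L²`-norm of `∑ r_j y_j`. On the other hand `∑ y_j(z_j)` is almost the square of this norm, so that
the summability of `A` bounds it (`radSq_le_of_forall_sum_le`).

The second implication asks for `∑ |y_j(z_j)| ≤ K ‖∑ r_j y_j‖_{L²} w_2(z)` for families `(y_j)` in
`X = E_n'` and `(z_j)` in `E_n`, where `w_2` is the weak `ℓ_2`-norm. The operator
`v : φ ↦ (φ z_j)_j` from `X` to `ℓ_2` has norm at most `w_2(z)`, and it is `1`-summing with constant
`K ‖v‖` (`IsGTSpace.exists_uniform`). For any orthonormal basis `u` of `ℝ^m`, the sum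
`∑ y_j(z_j)` is the trace of `v w`, where `w e_j = y_j`, so it is at most
`∑ ‖v (w u_k)‖ ≤ K ‖v‖ sup_φ ∑ |φ (w u_k)|`, and up to a factor `2` the supremum is the largest norm
of `w` at the vertices `∑ ± u_k` of a cube (`exists_norm_sum_apply_le`). It remains to choose `u` so
that these norms are controlled by the Rademacher average of `(y_j)`:

* Cotype `2` makes Gaussian averages comparable with Rademacher averages
  (`exists_gaussSq_le_radSq`). Thinning a family out by independent events of probability `1 / N`
  lowers the average of `‖∑ ± y_j‖²` by a factor of order `N`, because `N` disjoint copies of the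
  thinned family fit into the full one; this is applied to the dyadic levels of the Gaussian
  variables.
* Gaussian averages are invariant under rotations, so `w` is a `2`-summing operator
  (`exists_sum_norm_sq_le_radSq`).
* By the Hahn–Banach theorem, as in Pietsch's domination theorem, `‖w x‖²` is dominated by a
  quadratic form with controlled trace, whose eigenvectors form the basis `u`: at every vertex of
  the cube the form takes the value of its trace (`exists_orthonormalBasis_norm_sum_le`).
-/

open MeasureTheory
open scoped NNReal ENNReal

namespace MultilinearSumming

/-! ### Rademacher averages -/

/-- Integrating a function of the first `m` Rademacher functions over the unit interval amounts to
averaging it over all choices of signs. -/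
theorem setLIntegral_rademacher (m : ℕ) (F : (Fin m → ℝ) → ℝ≥0∞) :
    ∫⁻ t in Set.Ioo (0 : ℝ) 1, F (fun j => rademacher (j + 1) t) =
      (∑ ε : Fin m → ℤˣ, F (fun j => ((ε j : ℤ) : ℝ))) / 2 ^ m := by
  induction m with
  | zero =>
    simp only [Finset.univ_unique, Finset.sum_singleton, pow_zero, div_one]
    rw [show (fun t : ℝ => F fun j : Fin 0 => rademacher (j + 1) t) =
      fun _ => F (fun j => (((default : Fin 0 → ℤˣ) j : ℤ) : ℝ)) from
        funext fun t => congrArg F (Subsingleton.elim _ _)]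
    simp only [lintegral_const, Measure.restrict_apply_univ, Real.volume_Ioo, sub_zero,
      ENNReal.ofReal_one, mul_one]
    exact congrArg F (Subsingleton.elim _ _)
  | succ m ih =>
    -- on either half of the interval the first function is constant, and the remaining ones are
    -- rescaled copies of the whole system
    have hshift (j : ℕ) (t : ℝ) : rademacher (j + 1 + 1) t = rademacher (j + 1) (2 * t) := by
      unfold rademacher
      congr 2
      ring
    have hper (j : ℕ) (t : ℝ) : rademacher (j + 1) (t - 1) = rademacher (j + 1) t := by
      unfold rademacher
      have h : (2 : ℝ) ^ (j + 1) * Real.pi * (t - 1) =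
          2 ^ (j + 1) * Real.pi * t - ((2 ^ j : ℕ) : ℝ) * (2 * Real.pi) := by
        push_cast
        ring
      rw [h, Real.sin_sub_nat_mul_two_pi]
    have hpos (t : ℝ) (ht : t ∈ Set.Ioo (0 : ℝ) (1 / 2)) : rademacher (0 + 1) t = 1 := by
      unfold rademacher
      refine Real.sign_of_pos (Real.sin_pos_of_pos_of_lt_pi ?_ ?_)
      · have := Real.pi_pos
        have := ht.1
        positivity
      · have := Real.pi_pos
        have := ht.2
        norm_num
        nlinarith
    have hneg (t : ℝ) (ht : t ∈ Set.Ioo (1 / 2 : ℝ) 1) : rademacher (0 + 1) t = -1 := by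
      unfold rademacher
      refine Real.sign_of_neg ?_
      have h : (2 : ℝ) ^ (0 + 1) * Real.pi * t = (2 * t - 1) * Real.pi + Real.pi := by ring
      rw [h, Real.sin_add_pi, neg_lt_zero]
      have := ht.1
      have := ht.2
      refine Real.sin_pos_of_pos_of_lt_pi ?_ ?_
      · have : 0 < 2 * t - 1 := by linarith
        positivity
      · nlinarith [Real.pi_pos]
    have hcons (t : ℝ) : (fun j : Fin (m + 1) => rademacher (j + 1) t) =
        Fin.cons (rademacher (0 + 1) t) (fun j : Fin m => rademacher (j + 1) (2 * t)) := by
      funext j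
      refine Fin.cases ?_ (fun i => ?_) j
      · simp
      · simp [← hshift]
    have hsplit : ∫⁻ t in Set.Ioo (0 : ℝ) 1, F (fun j => rademacher (j + 1) t) =
        (∫⁻ t in Set.Ioo (0 : ℝ) (1 / 2), F (fun j => rademacher (j + 1) t)) +
          ∫⁻ t in Set.Ioo (1 / 2 : ℝ) 1, F (fun j => rademacher (j + 1) t) := by
      rw [← Set.Ioc_union_Ioo_eq_Ioo (by norm_num : (0 : ℝ) ≤ 1 / 2)
        (by norm_num : (1 / 2 : ℝ) < 1),
        lintegral_union measurableSet_Ioo]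
      · congr 1
        exact setLIntegral_congr Ioo_ae_eq_Ioc.symm
      · rw [Set.disjoint_left]
        intro t h1 h2
        exact absurd h1.2 (not_le.2 h2.1)
    have himg1 : (fun t : ℝ => 2 * t) '' Set.Ioo (0 : ℝ) (1 / 2) = Set.Ioo 0 1 := by
      rw [Set.image_mul_left_Ioo (by norm_num)]
      norm_num
    have himg2 : (fun t : ℝ => 2 * t - 1) '' Set.Ioo (1 / 2 : ℝ) 1 = Set.Ioo 0 1 := by
      have h := Set.image_affine_Ioo (a := (2 : ℝ)) (by norm_num) (-1) (1 / 2) 1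
      simp only [← sub_eq_add_neg] at h
      rw [h]
      norm_num
    have hhalf (G : ℝ → ℝ≥0∞) (f : ℝ → ℝ) (s : Set ℝ) (hs : MeasurableSet s)
        (hf : ∀ x, HasDerivAt f 2 x) (hinj : Set.InjOn f s) :
        ∫⁻ t in s, G (f t) = (∫⁻ t in f '' s, G t) / 2 := by
      rw [lintegral_image_eq_lintegral_abs_deriv_mul hs (fun x _ => (hf x).hasDerivWithinAt) hinj,
        lintegral_const_mul' _ _ (by simp), abs_of_pos (by norm_num : (0 : ℝ) < 2)]
      rw [ENNReal.ofReal_ofNat, mul_comm, ENNReal.mul_div_cancel_right (by simp) (by simp)]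
    have h1 : ∫⁻ t in Set.Ioo (0 : ℝ) (1 / 2), F (fun j => rademacher (j + 1) t) =
        ((∑ ε : Fin m → ℤˣ, F (Fin.cons 1 fun j => ((ε j : ℤ) : ℝ))) / 2 ^ m) / 2 := by
      rw [← ih (fun s => F (Fin.cons 1 s)), ← himg1,
        ← hhalf (fun t => F (Fin.cons 1 fun j : Fin m => rademacher (j + 1) t)) _ _
          measurableSet_Ioo (fun x => by simpa using (hasDerivAt_id x).const_mul (2 : ℝ))
          (fun a _ b _ h => by simpa using h)]
      refine setLIntegral_congr_fun measurableSet_Ioo fun t ht => ?_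
      rw [hcons, hpos t ht]
    have h2 : ∫⁻ t in Set.Ioo (1 / 2 : ℝ) 1, F (fun j => rademacher (j + 1) t) =
        ((∑ ε : Fin m → ℤˣ, F (Fin.cons (-1) fun j => ((ε j : ℤ) : ℝ))) / 2 ^ m) / 2 := by
      rw [← ih (fun s => F (Fin.cons (-1) s)), ← himg2,
        ← hhalf (fun t => F (Fin.cons (-1) fun j : Fin m => rademacher (j + 1) t)) _ _
          measurableSet_Ioo
          (fun x => by simpa using ((hasDerivAt_id x).const_mul (2 : ℝ)).sub_const 1)
          (fun a _ b _ h => by simpa using h)]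
      refine setLIntegral_congr_fun measurableSet_Ioo fun t ht => ?_
      rw [hcons, hneg t ht]
      simp only [hper]
    rw [hsplit, h1, h2, ← (Fin.consEquiv fun _ : Fin (m + 1) => ℤˣ).sum_comp,
      Fintype.sum_prod_type]
    have huniv : (Finset.univ : Finset ℤˣ) = {1, -1} := by decide
    rw [huniv, Finset.sum_pair (by decide), ENNReal.div_add_div_same, ENNReal.div_add_div_same,
      div_eq_mul_inv, div_eq_mul_inv, div_eq_mul_inv, mul_assoc,
      ← ENNReal.mul_inv (by simp) (by simp), ← pow_succ]
    congr 2
    · refine Finset.sum_congr rfl fun ε _ => congrArg F (funext fun j => ?_)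
      refine Fin.cases ?_ (fun i => ?_) j <;> simp [Fin.consEquiv]
    · refine Finset.sum_congr rfl fun ε _ => congrArg F (funext fun j => ?_)
      refine Fin.cases ?_ (fun i => ?_) j <;> simp [Fin.consEquiv]

section RadSq

variable {ι X : Type*} [Fintype ι] [DecidableEq ι] [NormedAddCommGroup X] [NormedSpace ℝ X]

/-- The Rademacher average `𝔼 ‖∑ ε_i y_i‖²` of a finite family, the signs being uniformly
distributed on `ι → {1, -1}`. -/
noncomputable def radSq (y : ι → X) : ℝ :=
  (∑ ε : ι → ℤˣ, ‖∑ i, ((ε i : ℤ) : ℝ) • y i‖ ^ 2) / 2 ^ Fintype.card ι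

theorem radSq_nonneg (y : ι → X) : 0 ≤ radSq y := by
  unfold radSq
  positivity

theorem card_signs : (Fintype.card (ι → ℤˣ) : ℝ) = 2 ^ Fintype.card ι := by
  simp

theorem radSq_sign_smul (η : ι → ℤˣ) (y : ι → X) :
    radSq (fun i => ((η i : ℤ) : ℝ) • y i) = radSq y := by
  unfold radSq
  congr 1
  rw [← Equiv.sum_comp (Equiv.mulRight η) fun ε : ι → ℤˣ => ‖∑ i, ((ε i : ℤ) : ℝ) • y i‖ ^ 2]
  simp [smul_smul]

theorem convexOn_norm_sq_comp {V : Type*} [AddCommGroup V] [Module ℝ V] (f : V →ₗ[ℝ] X) :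
    ConvexOn ℝ Set.univ fun s => ‖f s‖ ^ 2 := by
  have h : ConvexOn ℝ Set.univ fun s => ‖f s‖ := by
    exact (convexOn_univ_norm (E := X)).comp_linearMap f
  exact h.pow (fun _ _ => norm_nonneg _) 2

theorem convexOn_radSq_smul (y : ι → X) :
    ConvexOn ℝ Set.univ fun s : ι → ℝ => radSq (fun i => s i • y i) := by
  have h (ε : ι → ℤˣ) : ConvexOn ℝ Set.univ
      fun s : ι → ℝ => ‖∑ i, ((ε i : ℤ) : ℝ) • s i • y i‖ ^ 2 := by
    simpa using convexOn_norm_sq_comp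
      (∑ i, ((ε i : ℤ) : ℝ) • (LinearMap.proj i : (ι → ℝ) →ₗ[ℝ] ℝ).smulRight (y i))
  have hs : ConvexOn ℝ Set.univ
      fun s : ι → ℝ => ∑ ε : ι → ℤˣ, ‖∑ i, ((ε i : ℤ) : ℝ) • s i • y i‖ ^ 2 := by
    induction (Finset.univ : Finset (ι → ℤˣ)) using Finset.induction_on with
    | empty => simpa using convexOn_const (0 : ℝ) convex_univ
    | insert ε S hε ih => simpa only [Finset.sum_insert hε, Pi.add_def] using! (h ε).add ih
  simpa [radSq, div_eq_inv_mul] using hs.smul (c := ((2 : ℝ) ^ Fintype.card ι)⁻¹) (by positivity)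

theorem continuous_radSq_smul (y : ι → X) :
    Continuous fun s : ι → ℝ => radSq (fun i => s i • y i) := by
  unfold radSq
  fun_prop

/-- The contraction principle with coefficients in `[-1, 1]`: the cube is the convex hull of its
vertices, at which the average takes the same value. -/
theorem radSq_smul_le_of_abs_le_one (y : ι → X) (s : ι → ℝ) (hs : ∀ i, |s i| ≤ 1) :
    radSq (fun i => s i • y i) ≤ radSq y := by
  have hmem : s ∈ convexHull ℝ (Set.univ.pi fun _ : ι => ({-1, 1} : Set ℝ)) := by
    rw [convexHull_pi]
    intro i _
    rw [convexHull_pair, segment_eq_Icc (by norm_num)]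
    exact abs_le.1 (hs i)
  obtain ⟨v, hv, hle⟩ := (convexOn_radSq_smul y).exists_ge_of_mem_convexHull
    (Set.subset_univ _) hmem
  have hex (i : ι) : ∃ η : ℤˣ, ((η : ℤ) : ℝ) = v i := by
    rcases hv i (Set.mem_univ i) with h | h
    · exact ⟨-1, by simp [h]⟩
    · exact ⟨1, by simpa using h.symm⟩
  choose η hη using hex
  refine hle.trans_eq ?_
  simp only [← hη]
  exact radSq_sign_smul η y

theorem radSq_smul_mono (y : ι → X) (b c : ι → ℝ) (hbc : ∀ i, |b i| ≤ c i) :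
    radSq (fun i => b i • y i) ≤ radSq (fun i => c i • y i) := by
  have h := radSq_smul_le_of_abs_le_one (fun i => c i • y i) (fun i => b i / c i) fun i => by
    rw [abs_div, abs_of_nonneg ((abs_nonneg _).trans (hbc i))]
    exact div_le_one_of_le₀ (hbc i) ((abs_nonneg _).trans (hbc i))
  convert h using 3 with i
  rcases eq_or_ne (c i) 0 with h0 | h0
  · have : b i = 0 := abs_eq_zero.1 (le_antisymm (h0 ▸ hbc i) (abs_nonneg _))
    simp [h0, this]
  · rw [smul_smul, div_mul_cancel₀ _ h0]

/-- A cotype `2` inequality with squared constant `c` makes Rademacher averages superadditive, up to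
the factor `c`, over families of multipliers such as the indicators of disjoint sets of indices. -/
theorem sum_radSq_smul_le {c : ℝ} (hc0 : 0 ≤ c)
    (hc : ∀ (N : ℕ) (x : Fin N → X), ∑ k, ‖x k‖ ^ 2 ≤ c * radSq x) (y : ι → X) {N : ℕ}
    (b : Fin N → ι → ℝ) (hb : ∀ i, ∑ k, |b k i| ≤ 1) :
    ∑ k, radSq (fun i => b k i • y i) ≤ c * radSq y := by
  have key (ε : ι → ℤˣ) : ∑ k, ‖∑ i, ((ε i : ℤ) : ℝ) • b k i • y i‖ ^ 2 ≤
      c * ((∑ δ : Fin N → ℤˣ,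
        ‖∑ i, ((ε i : ℤ) : ℝ) • (∑ k, ((δ k : ℤ) : ℝ) * b k i) • y i‖ ^ 2) / 2 ^ N) := by
    refine (hc N _).trans_eq ?_
    unfold radSq
    rw [Fintype.card_fin]
    congr 2
    refine Finset.sum_congr rfl fun δ _ => ?_
    congr 2
    simp only [Finset.smul_sum, Finset.sum_smul, smul_smul]
    rw [Finset.sum_comm]
    refine Finset.sum_congr rfl fun i _ => Finset.sum_congr rfl fun k _ => ?_
    congr 1
    ring
  have hδ (δ : Fin N → ℤˣ) :
      radSq (fun i => (∑ k, ((δ k : ℤ) : ℝ) * b k i) • y i) ≤ radSq y := by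
    refine radSq_smul_le_of_abs_le_one y _ fun i => ?_
    refine (Finset.abs_sum_le_sum_abs _ _).trans (le_trans (le_of_eq ?_) (hb i))
    refine Finset.sum_congr rfl fun k _ => ?_
    rcases Int.units_eq_one_or (δ k) with h | h <;> simp [h]
  calc ∑ k, radSq (fun i => b k i • y i)
      = (∑ ε : ι → ℤˣ, ∑ k, ‖∑ i, ((ε i : ℤ) : ℝ) • b k i • y i‖ ^ 2) / 2 ^ Fintype.card ι := by
        unfold radSq
        rw [← Finset.sum_div, Finset.sum_comm]
    _ ≤ (∑ ε : ι → ℤˣ, c * ((∑ δ : Fin N → ℤˣ,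
          ‖∑ i, ((ε i : ℤ) : ℝ) • (∑ k, ((δ k : ℤ) : ℝ) * b k i) • y i‖ ^ 2) / 2 ^ N)) /
            2 ^ Fintype.card ι := by
        gcongr with ε
        exact key ε
    _ = c * ((∑ δ : Fin N → ℤˣ, radSq (fun i => (∑ k, ((δ k : ℤ) : ℝ) * b k i) • y i)) /
          2 ^ N) := by
        unfold radSq
        rw [← Finset.mul_sum, ← Finset.sum_div, ← Finset.sum_div, Finset.sum_comm]
        ring
    _ ≤ c * ((∑ _δ : Fin N → ℤˣ, radSq y) / 2 ^ N) := by
        gcongr with δ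
        exact hδ δ
    _ = c * radSq y := by
        rw [Finset.sum_const, nsmul_eq_mul, Finset.card_univ, card_signs, Fintype.card_fin]
        field_simp

end RadSq

/-! ### Gaussian averages -/

section Gaussian

open ProbabilityTheory

variable {ι X : Type*} [Fintype ι] [NormedAddCommGroup X] [NormedSpace ℝ X]

/-- The law of `ι` independent standard Gaussian variables. -/
noncomputable def gaussPi (ι : Type*) [Fintype ι] : Measure (ι → ℝ) :=
  Measure.pi fun _ => gaussianReal 0 1

instance : IsProbabilityMeasure (gaussPi ι) := by
  unfold gaussPi
  infer_instance

/-- The Gaussian average `𝔼 ‖∑ g_i y_i‖²` of a finite family, with values in `[0, ∞]`. -/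
noncomputable def gaussSq (y : ι → X) : ℝ≥0∞ :=
  ∫⁻ g, ENNReal.ofReal (‖∑ i, g i • y i‖ ^ 2) ∂gaussPi ι

theorem map_sign_gaussPi (ε : ι → ℤˣ) :
    (gaussPi ι).map (fun g i => ((ε i : ℤ) : ℝ) * g i) = gaussPi ι := by
  unfold gaussPi
  have h (i : ι) : (gaussianReal 0 1).map (fun t => ((ε i : ℤ) : ℝ) * t) = gaussianReal 0 1 := by
    rw [gaussianReal_map_const_mul]
    rcases Int.units_eq_one_or (ε i) with h | h <;> simp [h]
  have (i : ι) : SigmaFinite ((gaussianReal 0 1).map fun t => ((ε i : ℤ) : ℝ) * t) := by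
    rw [h]
    infer_instance
  rw [Measure.pi_map_pi (f := fun i (t : ℝ) => ((ε i : ℤ) : ℝ) * t)
    fun i => (measurable_const_mul _).aemeasurable]
  simp only [h]

/-- By symmetry of the Gaussian law, signs may be averaged out. -/
theorem gaussSq_eq_lintegral_radSq [DecidableEq ι] (y : ι → X) :
    gaussSq y = ∫⁻ g, ENNReal.ofReal (radSq fun i => g i • y i) ∂gaussPi ι := by
  have hcont : Continuous fun g : ι → ℝ => ENNReal.ofReal (‖∑ i, g i • y i‖ ^ 2) :=
    ENNReal.continuous_ofReal.comp (by fun_prop)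
  have hε (ε : ι → ℤˣ) :
      ∫⁻ g, ENNReal.ofReal (‖∑ i, ((ε i : ℤ) : ℝ) • g i • y i‖ ^ 2) ∂gaussPi ι = gaussSq y := by
    unfold gaussSq
    conv_rhs => rw [← map_sign_gaussPi ε, lintegral_map hcont.measurable (by fun_prop)]
    simp only [smul_smul]
  have hr (g : ι → ℝ) : ENNReal.ofReal (radSq fun i => g i • y i) =
      (∑ ε : ι → ℤˣ, ENNReal.ofReal (‖∑ i, ((ε i : ℤ) : ℝ) • g i • y i‖ ^ 2)) *
        (2 ^ Fintype.card ι)⁻¹ := by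
    unfold radSq
    rw [ENNReal.ofReal_div_of_pos (by positivity), ENNReal.ofReal_sum_of_nonneg
      (fun _ _ => by positivity), ENNReal.ofReal_pow (by norm_num), ENNReal.ofReal_ofNat,
      div_eq_mul_inv]
  simp only [hr]
  have hm (ε : ι → ℤˣ) : Measurable fun g : ι → ℝ =>
      ENNReal.ofReal (‖∑ i, ((ε i : ℤ) : ℝ) • g i • y i‖ ^ 2) :=
    (ENNReal.continuous_ofReal.comp (by fun_prop)).measurable
  rw [lintegral_mul_const _ (Finset.measurable_sum _ fun ε _ => hm ε),
    lintegral_finsetSum _ fun ε _ => hm ε]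
  simp only [hε]
  rw [Finset.sum_const, nsmul_eq_mul, Finset.card_univ]
  have : ((Fintype.card (ι → ℤˣ) : ℕ) : ℝ≥0∞) = 2 ^ Fintype.card ι := by simp
  rw [this, mul_right_comm, ENNReal.mul_inv_cancel (by simp) (by simp), one_mul]

theorem lintegral_sq_gaussianReal :
    ∫⁻ t, ENNReal.ofReal (t ^ 2) ∂gaussianReal 0 1 = 1 := by
  have h := variance_id_gaussianReal (μ := 0) (v := 1)
  rw [variance_of_integral_eq_zero aemeasurable_id (by simp)] at h
  rw [← ofReal_integral_eq_lintegral_ofReal]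
  · simpa using congrArg ENNReal.ofReal h
  · exact (memLp_id_gaussianReal' 2 (by simp)).integrable_sq
  · exact Filter.Eventually.of_forall fun t => sq_nonneg t

/-- A Rademacher cotype `2` inequality implies the Gaussian one, applied conditionally to
`g_k x_k`. -/
theorem sum_norm_sq_le_gaussSq {c : ℝ} (hc0 : 0 ≤ c)
    (hc : ∀ (N : ℕ) (x : Fin N → X), ∑ k, ‖x k‖ ^ 2 ≤ c * radSq x) {N : ℕ} (x : Fin N → X) :
    ENNReal.ofReal (∑ k, ‖x k‖ ^ 2) ≤ ENNReal.ofReal c * gaussSq x := by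
  have heval (k : Fin N) : ∫⁻ g, ENNReal.ofReal (g k ^ 2) ∂gaussPi (Fin N) = 1 := by
    rw [← lintegral_sq_gaussianReal]
    exact (measurePreserving_eval (fun _ : Fin N => gaussianReal 0 1) k).lintegral_comp
      (f := fun t => ENNReal.ofReal (t ^ 2)) (by fun_prop)
  calc ENNReal.ofReal (∑ k, ‖x k‖ ^ 2)
      = ∫⁻ g, ENNReal.ofReal (∑ k, ‖g k • x k‖ ^ 2) ∂gaussPi (Fin N) := by
        have (g : Fin N → ℝ) : ENNReal.ofReal (∑ k, ‖g k • x k‖ ^ 2) =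
            ∑ k, ENNReal.ofReal (g k ^ 2) * ENNReal.ofReal (‖x k‖ ^ 2) := by
          rw [ENNReal.ofReal_sum_of_nonneg fun _ _ => by positivity]
          refine Finset.sum_congr rfl fun k _ => ?_
          rw [← ENNReal.ofReal_mul (sq_nonneg _), norm_smul, mul_pow, Real.norm_eq_abs, sq_abs]
        simp only [this]
        rw [lintegral_finsetSum _ fun k _ => by fun_prop,
          ENNReal.ofReal_sum_of_nonneg fun _ _ => by positivity]
        refine Finset.sum_congr rfl fun k _ => ?_
        rw [lintegral_mul_const _ (by fun_prop), heval, one_mul]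
    _ ≤ ∫⁻ g, ENNReal.ofReal c * ENNReal.ofReal (radSq fun k => g k • x k) ∂gaussPi (Fin N) := by
        refine lintegral_mono fun g => ?_
        rw [← ENNReal.ofReal_mul hc0]
        exact ENNReal.ofReal_le_ofReal (hc N _)
    _ = ENNReal.ofReal c * gaussSq x := by
        rw [gaussSq_eq_lintegral_radSq,
          lintegral_const_mul _ (continuous_radSq_smul x).measurable.ennreal_ofReal]

/-! ### Comparison of Gaussian and Rademacher averages -/

/-- The law of a random subset of `ι`, given by independent events of equal probability, only
depends on this probability. -/
theorem lintegral_pi_indicator_eq {Ω Ω' : Type*} [MeasurableSpace Ω] [MeasurableSpace Ω']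
    (μ : Measure Ω) (ν : Measure Ω') [IsProbabilityMeasure μ] [IsProbabilityMeasure ν]
    {A : Set Ω} {B : Set Ω'} (hA : MeasurableSet A) (hB : MeasurableSet B) (h : μ A = ν B)
    {F : (ι → ℝ) → ℝ≥0∞} (hF : Measurable F) :
    ∫⁻ x, F (fun i => A.indicator 1 (x i)) ∂(Measure.pi fun _ => μ) =
      ∫⁻ x, F (fun i => B.indicator 1 (x i)) ∂(Measure.pi fun _ => ν) := by
  have hfA : Measurable (A.indicator (1 : Ω → ℝ)) := measurable_one.indicator hA
  have hfB : Measurable (B.indicator (1 : Ω' → ℝ)) := measurable_one.indicator hB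
  have hlaw : μ.map (A.indicator (1 : Ω → ℝ)) = ν.map (B.indicator (1 : Ω' → ℝ)) := by
    have hc : μ Aᶜ = ν Bᶜ := by rw [prob_compl_eq_one_sub hA, prob_compl_eq_one_sub hB, h]
    ext s hs
    rw [Measure.map_apply hfA hs, Measure.map_apply hfB hs]
    classical
    rw [Pi.one_def, Pi.one_def, Set.indicator_const_preimage_eq_union,
      Set.indicator_const_preimage_eq_union]
    by_cases h0 : (0 : ℝ) ∈ s <;> by_cases h1 : (1 : ℝ) ∈ s <;> simp [h0, h1, h, hc]
  have : IsProbabilityMeasure (μ.map (A.indicator (1 : Ω → ℝ))) :=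
    Measure.isProbabilityMeasure_map hfA.aemeasurable
  have : IsProbabilityMeasure (ν.map (B.indicator (1 : Ω' → ℝ))) :=
    Measure.isProbabilityMeasure_map hfB.aemeasurable
  have e1 := Measure.pi_map_pi (μ := fun _ : ι => μ) (f := fun _ => A.indicator (1 : Ω → ℝ))
    fun _ => hfA.aemeasurable
  have e2 := Measure.pi_map_pi (μ := fun _ : ι => ν) (f := fun _ => B.indicator (1 : Ω' → ℝ))
    fun _ => hfB.aemeasurable
  rw [← lintegral_map (μ := Measure.pi fun _ : ι => μ) hF (g := fun x i => A.indicator 1 (x i))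
      (by fun_prop), e1, hlaw, ← e2, lintegral_map hF (by fun_prop)]

/-- If the indices are kept independently with probability at most `1 / N`, then cotype `2`
bounds the expected Rademacher average of the remaining family by `c / N` times the full one: it is
realised by `N` disjoint random sets of indices with the same law. -/
theorem lintegral_radSq_indicator_le [DecidableEq ι] {c : ℝ} (hc0 : 0 ≤ c)
    (hc : ∀ (N : ℕ) (x : Fin N → X), ∑ k, ‖x k‖ ^ 2 ≤ c * radSq x) (y : ι → X)
    (μ : Measure ℝ) [IsProbabilityMeasure μ] {A : Set ℝ} (hA : MeasurableSet A) {N : ℕ}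
    (hN : N * μ A ≤ 1) :
    N * ∫⁻ x, ENNReal.ofReal (radSq fun i => A.indicator (1 : ℝ → ℝ) (x i) • y i)
      ∂(Measure.pi fun _ => μ) ≤ ENNReal.ofReal (c * radSq y) := by
  set p : ℝ := (μ A).toReal with hp
  have hp0 : 0 ≤ p := ENNReal.toReal_nonneg
  have hNp : N * p ≤ 1 := by
    have := ENNReal.toReal_mono (by simp) hN
    simpa [hp] using this
  let ν : Measure ℝ := volume.restrict (Set.Ioo 0 1)
  have : IsProbabilityMeasure ν := ⟨by simp [ν]⟩
  -- `N` disjoint intervals of length `p`, which fit into the unit interval as `N p ≤ 1`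
  let B (k : Fin N) : Set ℝ := Set.Ioo (k * p) ((k + 1) * p)
  have hBm (k : Fin N) : MeasurableSet (B k) := measurableSet_Ioo
  have hsub (k : Fin N) : B k ⊆ Set.Ioo 0 1 := by
    intro t ht
    have h1 : (0 : ℝ) ≤ k * p := by positivity
    have h2 : ((k : ℝ) + 1) * p ≤ N * p := by
      gcongr
      exact_mod_cast k.2
    exact ⟨h1.trans_lt ht.1, ht.2.trans_le (h2.trans hNp)⟩
  have hνB (k : Fin N) : μ A = ν (B k) := by
    rw [Measure.restrict_apply (hBm k), Set.inter_eq_self_of_subset_left (hsub k), Real.volume_Ioo,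
      show ((k : ℝ) + 1) * p - k * p = p by ring, hp, ENNReal.ofReal_toReal (measure_ne_top _ _)]
  have hdisj (t : ℝ) : ∑ k, |(B k).indicator (1 : ℝ → ℝ) t| ≤ 1 := by
    by_cases h : ∃ k, t ∈ B k
    · obtain ⟨k, hk⟩ := h
      rw [Finset.sum_eq_single k]
      · simp [hk]
      · intro l _ hl
        have : t ∉ B l := by
          intro ht
          apply hl
          have hpp : 0 < p := by
            have := ht.1.trans ht.2
            nlinarith
          have h1 : (l : ℝ) < k + 1 := by
            have := ht.1.trans hk.2
            exact lt_of_mul_lt_mul_right this hp0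
          have h2 : (k : ℝ) < l + 1 := by
            have := hk.1.trans ht.2
            exact lt_of_mul_lt_mul_right this hp0
          have h1' : (l : ℕ) < k + 1 := by exact_mod_cast h1
          have h2' : (k : ℕ) < l + 1 := by exact_mod_cast h2
          exact Fin.ext (by omega)
        simp [this]
      · simp
    · push Not at h
      simp [h]
  have hF : Measurable fun s : ι → ℝ => ENNReal.ofReal (radSq fun i => s i • y i) :=
    (continuous_radSq_smul y).measurable.ennreal_ofReal
  have hmeas (k : Fin N) : Measurable fun x : ι → ℝ =>
      ENNReal.ofReal (radSq fun i => (B k).indicator (1 : ℝ → ℝ) (x i) • y i) := by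
    have hk : Measurable ((B k).indicator (1 : ℝ → ℝ)) := measurable_one.indicator (hBm k)
    exact hF.comp (by fun_prop)
  calc N * ∫⁻ x, ENNReal.ofReal (radSq fun i => A.indicator (1 : ℝ → ℝ) (x i) • y i)
        ∂(Measure.pi fun _ => μ)
      = ∑ k : Fin N, ∫⁻ x, ENNReal.ofReal (radSq fun i => (B k).indicator (1 : ℝ → ℝ) (x i) • y i)
          ∂(Measure.pi fun _ => ν) := by
        rw [← Finset.sum_congr rfl fun k _ => lintegral_pi_indicator_eq μ ν hA (hBm k) (hνB k) hF]
        simp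
    _ = ∫⁻ x, ENNReal.ofReal (∑ k, radSq fun i => (B k).indicator (1 : ℝ → ℝ) (x i) • y i)
          ∂(Measure.pi fun _ => ν) := by
        rw [← lintegral_finsetSum _ fun k _ => hmeas k]
        simp only [ENNReal.ofReal_sum_of_nonneg fun _ _ => radSq_nonneg _]
    _ ≤ ∫⁻ _, ENNReal.ofReal (c * radSq y) ∂(Measure.pi fun _ => ν) := by
        refine lintegral_mono fun x => ENNReal.ofReal_le_ofReal ?_
        exact sum_radSq_smul_le hc0 hc y _ fun i => hdisj (x i)
    _ = ENNReal.ofReal (c * radSq y) := by simp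

end Gaussian

section GaussianRademacher

open ProbabilityTheory

variable {ι X : Type*} [Fintype ι] [DecidableEq ι] [NormedAddCommGroup X] [NormedSpace ℝ X]

/-- The set where a variable exceeds the `l`-th dyadic multiple of `K` in absolute value. -/
def dyadicTail (K : ℝ) (l : ℕ) : Set ℝ := {t | K * 2 ^ l < |t|}

theorem measurableSet_dyadicTail (K : ℝ) (l : ℕ) : MeasurableSet (dyadicTail K l) :=
  measurableSet_lt measurable_const measurable_id.abs

/-- Chebyshev's inequality for the fourth moment. The rate `16⁻ˡ` beats the growth `4ˡ` of the
squares of the levels. -/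
theorem exists_gaussianReal_dyadicTail_le :
    ∃ K : ℝ, 0 < K ∧ ∀ l : ℕ, ((16 ^ l : ℕ) : ℝ≥0∞) * gaussianReal 0 1 (dyadicTail K l) ≤ 1 := by
  have hint : Integrable (fun t : ℝ => t ^ 4) (gaussianReal 0 1) := by
    have := (memLp_id_gaussianReal' (μ := 0) (v := 1) 4 (by simp)).integrable_norm_pow (by simp)
    simpa [Even.pow_abs (by decide : Even 4)] using this
  set I := ∫⁻ t, ENNReal.ofReal (t ^ 4) ∂gaussianReal 0 1 with hI
  have hItop : I ≠ ∞ := hint.lintegral_lt_top.ne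
  let K : ℝ := I.toReal + 1
  have hK1 : 1 ≤ K := by simp [K]
  have hIK : I ≤ ENNReal.ofReal (K ^ 4) := by
    rw [← ENNReal.ofReal_toReal hItop]
    refine ENNReal.ofReal_le_ofReal ?_
    calc I.toReal ≤ K := by simp [K]
      _ ≤ K ^ 4 := le_self_pow₀ hK1 (by norm_num)
  refine ⟨K, by linarith, fun l => ?_⟩
  have hsub : dyadicTail K l ⊆
      {t | ENNReal.ofReal (K ^ 4 * 16 ^ l) ≤ ENNReal.ofReal (t ^ 4)} := by
    intro t ht
    refine ENNReal.ofReal_le_ofReal ?_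
    have h1 : (K * 2 ^ l) ^ 4 ≤ |t| ^ 4 := by
      have : 0 ≤ K * 2 ^ l := by positivity
      have : K * 2 ^ l ≤ |t| := le_of_lt (show K * 2 ^ l < |t| from ht)
      gcongr
    rw [Even.pow_abs (by decide : Even 4), mul_pow, ← pow_mul, mul_comm l 4, pow_mul] at h1
    norm_num at h1
    exact h1
  have hmarkov := mul_meas_ge_le_lintegral (μ := gaussianReal 0 1)
    (f := fun t : ℝ => ENNReal.ofReal (t ^ 4)) (by fun_prop) (ENNReal.ofReal (K ^ 4 * 16 ^ l))
  have h := (mul_le_mul_right (measure_mono hsub) _).trans (hmarkov.trans hIK)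
  rw [ENNReal.ofReal_mul (by positivity), mul_assoc] at h
  have h0 : ENNReal.ofReal (K ^ 4) ≠ 0 := by
    rw [Ne, ENNReal.ofReal_eq_zero, not_le]
    positivity
  have h' : ENNReal.ofReal (16 ^ l) * gaussianReal 0 1 (dyadicTail K l) ≤ 1 := by
    refine (ENNReal.mul_le_mul_iff_right h0 ENNReal.ofReal_ne_top).1 ?_
    rwa [mul_one]
  refine le_trans (le_of_eq ?_) h'
  rw [ENNReal.ofReal_pow (by norm_num), ENNReal.ofReal_ofNat]
  push_cast
  rfl

theorem abs_le_sum_dyadicTail {K : ℝ} (hK : 0 < K) (L : ℕ) (t : ℝ) (ht : |t| ≤ K * 2 ^ L) :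
    |t| ≤ K * (1 + ∑ l ∈ Finset.range L, 2 ^ l * (dyadicTail K l).indicator (1 : ℝ → ℝ) t) := by
  induction L with
  | zero => simpa using ht
  | succ L ih =>
    by_cases h : |t| ≤ K * 2 ^ L
    · refine (ih h).trans ?_
      gcongr
      · intro i _ _
        have : 0 ≤ (dyadicTail K i).indicator (1 : ℝ → ℝ) t :=
          Set.indicator_nonneg (fun _ _ => zero_le_one) _
        positivity
      · simp
    · push Not at h
      have hmem : ∀ l ∈ Finset.range (L + 1), t ∈ dyadicTail K l := by
        intro l hl
        refine lt_of_le_of_lt ?_ h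
        gcongr
        · norm_num
        · exact Finset.mem_range_succ_iff.1 hl
      have hsum : ∑ l ∈ Finset.range (L + 1),
          2 ^ l * (dyadicTail K l).indicator (1 : ℝ → ℝ) t = 2 ^ (L + 1) - 1 := by
        rw [Finset.sum_congr rfl fun l hl => by
          rw [Set.indicator_of_mem (hmem l hl), Pi.one_apply, mul_one], geom_sum_eq (by norm_num)]
        norm_num
      rw [hsum]
      simpa using ht

/-- Splitting the coefficients `h` into dyadic levels. -/
theorem radSq_smul_le_tsum_dyadicTail {K : ℝ} (hK : 0 < K) (y : ι → X) (h : ι → ℝ) :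
    ENNReal.ofReal (radSq fun i => h i • y i) ≤ ENNReal.ofReal (4 * K ^ 2) *
      (ENNReal.ofReal (radSq y) + ∑' l : ℕ, 8 ^ l * ENNReal.ofReal
        (radSq fun i => (dyadicTail K l).indicator (1 : ℝ → ℝ) (h i) • y i)) := by
  obtain ⟨L, hL⟩ : ∃ L : ℕ, ∀ i, |h i| ≤ K * 2 ^ L := by
    obtain ⟨L, hL⟩ := pow_unbounded_of_one_lt ((∑ i, |h i|) / K) (one_lt_two (α := ℝ))
    refine ⟨L, fun i => ?_⟩
    rw [div_lt_iff₀ hK, mul_comm] at hL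
    exact (Finset.single_le_sum (f := fun i => |h i|) (fun _ _ => abs_nonneg _)
      (Finset.mem_univ i)).trans hL.le
  have hsq (x : ℝ) (a : ℕ → ℝ) :
      (x + ∑ l ∈ Finset.range L, 2 ^ l * a l) ^ 2 ≤
        4 * (x ^ 2 + ∑ l ∈ Finset.range L, 8 ^ l * a l ^ 2) := by
    -- Cauchy–Schwarz with the summable weights `2⁻ˡ`
    have h1 : (∑ l ∈ Finset.range L, 2 ^ l * a l) ^ 2 ≤
        (∑ l ∈ Finset.range L, (1 / 2 : ℝ) ^ l) * ∑ l ∈ Finset.range L, 8 ^ l * a l ^ 2 := by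
      refine Finset.sum_sq_le_sum_mul_sum_of_sq_le_mul _ (fun _ _ => by positivity)
        (fun _ _ => by positivity) fun l _ => ?_
      rw [← mul_assoc, ← mul_pow, mul_pow, ← pow_mul, mul_comm l 2, pow_mul]
      norm_num
    have h2 : ∑ l ∈ Finset.range L, (1 / 2 : ℝ) ^ l ≤ 2 := sum_geometric_two_le L
    have h3 : 0 ≤ ∑ l ∈ Finset.range L, 8 ^ l * a l ^ 2 :=
      Finset.sum_nonneg fun _ _ => by positivity
    have h4 := mul_le_mul_of_nonneg_right h2 h3
    nlinarith [sq_nonneg (x - ∑ l ∈ Finset.range L, 2 ^ l * a l), sq_nonneg x]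
  have hreal : radSq (fun i => h i • y i) ≤ 4 * K ^ 2 * (radSq y + ∑ l ∈ Finset.range L,
      8 ^ l * radSq fun i => (dyadicTail K l).indicator (1 : ℝ → ℝ) (h i) • y i) := by
    refine (radSq_smul_mono y h _ fun i => abs_le_sum_dyadicTail hK L (h i) (hL i)).trans ?_
    have hε (ε : ι → ℤˣ) : ‖∑ i, ((ε i : ℤ) : ℝ) • (K * (1 + ∑ l ∈ Finset.range L,
          2 ^ l * (dyadicTail K l).indicator (1 : ℝ → ℝ) (h i))) • y i‖ ^ 2 ≤
        4 * K ^ 2 * (‖∑ i, ((ε i : ℤ) : ℝ) • y i‖ ^ 2 + ∑ l ∈ Finset.range L, 8 ^ l *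
          ‖∑ i, ((ε i : ℤ) : ℝ) • (dyadicTail K l).indicator (1 : ℝ → ℝ) (h i) • y i‖ ^ 2) := by
      have heq : ∑ i, ((ε i : ℤ) : ℝ) • (K * (1 + ∑ l ∈ Finset.range L,
            2 ^ l * (dyadicTail K l).indicator (1 : ℝ → ℝ) (h i))) • y i =
          K • (∑ i, ((ε i : ℤ) : ℝ) • y i + ∑ l ∈ Finset.range L, (2 : ℝ) ^ l •
            ∑ i, ((ε i : ℤ) : ℝ) • (dyadicTail K l).indicator (1 : ℝ → ℝ) (h i) • y i) := by
        simp only [Finset.smul_sum, smul_smul]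
        rw [Finset.sum_comm, ← Finset.sum_add_distrib, Finset.smul_sum]
        refine Finset.sum_congr rfl fun i _ => ?_
        rw [← Finset.sum_smul, ← add_smul, smul_smul]
        congr 1
        simp only [mul_add, Finset.mul_sum, mul_one]
        congr 1
        · ring
        · exact Finset.sum_congr rfl fun l _ => by ring
      rw [heq, norm_smul, mul_pow, Real.norm_eq_abs, sq_abs, mul_comm 4, mul_assoc]
      refine mul_le_mul_of_nonneg_left ?_ (sq_nonneg K)
      refine le_trans ?_ (hsq _ _)
      gcongr
      refine (norm_add_le _ _).trans ?_
      gcongr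
      refine (norm_sum_le _ _).trans (le_of_eq ?_)
      refine Finset.sum_congr rfl fun l _ => ?_
      rw [norm_smul, Real.norm_eq_abs, abs_of_nonneg (by positivity)]
    unfold radSq
    calc _ ≤ (∑ ε : ι → ℤˣ, 4 * K ^ 2 * (‖∑ i, ((ε i : ℤ) : ℝ) • y i‖ ^ 2 +
          ∑ l ∈ Finset.range L, 8 ^ l * ‖∑ i, ((ε i : ℤ) : ℝ) •
            (dyadicTail K l).indicator (1 : ℝ → ℝ) (h i) • y i‖ ^ 2)) / 2 ^ Fintype.card ι := by
          gcongr with ε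
          exact hε ε
      _ = _ := by
          rw [← Finset.mul_sum, Finset.sum_add_distrib, Finset.sum_comm, mul_div_assoc, add_div,
            Finset.sum_div (Finset.range L)]
          simp only [← Finset.mul_sum, mul_div_assoc]
  refine (ENNReal.ofReal_le_ofReal hreal).trans ?_
  have hnn (l : ℕ) :
      0 ≤ radSq fun i => (dyadicTail K l).indicator (1 : ℝ → ℝ) (h i) • y i := radSq_nonneg _
  rw [ENNReal.ofReal_mul (by positivity), ENNReal.ofReal_add (radSq_nonneg _)
    (Finset.sum_nonneg fun l _ => mul_nonneg (by positivity) (hnn l)),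
    ENNReal.ofReal_sum_of_nonneg fun l _ => mul_nonneg (by positivity) (hnn l)]
  gcongr
  refine le_trans (le_of_eq ?_) (ENNReal.sum_le_tsum (Finset.range L))
  refine Finset.sum_congr rfl fun l _ => ?_
  rw [ENNReal.ofReal_mul (by positivity), ENNReal.ofReal_pow (by norm_num), ENNReal.ofReal_ofNat]

/-- In a space of cotype `2` Gaussian averages are dominated by Rademacher averages. -/
theorem exists_gaussSq_le_radSq {c : ℝ} (hc0 : 0 ≤ c)
    (hc : ∀ (N : ℕ) (x : Fin N → X), ∑ k, ‖x k‖ ^ 2 ≤ c * radSq x) :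
    ∃ D : ℝ, 0 < D ∧ ∀ (m : ℕ) (y : Fin m → X), gaussSq y ≤ ENNReal.ofReal (D * radSq y) := by
  obtain ⟨K, hK, htail⟩ := exists_gaussianReal_dyadicTail_le
  refine ⟨4 * K ^ 2 * (1 + 2 * c), by positivity, fun m y => ?_⟩
  have hlevel (l : ℕ) : (8 : ℝ≥0∞) ^ l * ∫⁻ g, ENNReal.ofReal
      (radSq fun i => (dyadicTail K l).indicator (1 : ℝ → ℝ) (g i) • y i) ∂gaussPi (Fin m) ≤
        2⁻¹ ^ l * ENNReal.ofReal (c * radSq y) := by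
    have h := lintegral_radSq_indicator_le hc0 hc y (gaussianReal 0 1)
      (measurableSet_dyadicTail K l) (htail l)
    refine le_trans (le_of_eq ?_) (mul_le_mul_right h _)
    rw [← mul_assoc]
    congr 1
    push_cast
    rw [← mul_pow, show (16 : ℝ≥0∞) = 2 * 8 by norm_num, ← mul_assoc,
      ENNReal.inv_mul_cancel (by simp) (by simp), one_mul]
  have hmeas (l : ℕ) : Measurable fun g : Fin m → ℝ => ENNReal.ofReal
      (radSq fun i => (dyadicTail K l).indicator (1 : ℝ → ℝ) (g i) • y i) := by
    have hl : Measurable ((dyadicTail K l).indicator (1 : ℝ → ℝ)) :=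
      measurable_one.indicator (measurableSet_dyadicTail K l)
    have hcomp : Measurable fun (g : Fin m → ℝ) i =>
        (dyadicTail K l).indicator (1 : ℝ → ℝ) (g i) := by fun_prop
    exact ((continuous_radSq_smul y).measurable.comp hcomp).ennreal_ofReal
  have hmeas' (l : ℕ) : Measurable fun g : Fin m → ℝ => (8 : ℝ≥0∞) ^ l * ENNReal.ofReal
      (radSq fun i => (dyadicTail K l).indicator (1 : ℝ → ℝ) (g i) • y i) :=
    (hmeas l).const_mul _
  rw [gaussSq_eq_lintegral_radSq]
  calc ∫⁻ g, ENNReal.ofReal (radSq fun i => g i • y i) ∂gaussPi (Fin m)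
      ≤ ∫⁻ g, ENNReal.ofReal (4 * K ^ 2) * (ENNReal.ofReal (radSq y) + ∑' l : ℕ, 8 ^ l *
          ENNReal.ofReal (radSq fun i => (dyadicTail K l).indicator (1 : ℝ → ℝ) (g i) • y i))
            ∂gaussPi (Fin m) :=
        lintegral_mono fun g => radSq_smul_le_tsum_dyadicTail hK y g
    _ = ENNReal.ofReal (4 * K ^ 2) * (ENNReal.ofReal (radSq y) + ∑' l : ℕ, 8 ^ l * ∫⁻ g,
          ENNReal.ofReal (radSq fun i => (dyadicTail K l).indicator (1 : ℝ → ℝ) (g i) • y i)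
            ∂gaussPi (Fin m)) := by
        rw [lintegral_const_mul _ ((Measurable.tsum hmeas').const_add _),
          lintegral_add_left measurable_const, lintegral_tsum fun l => (hmeas' l).aemeasurable]
        simp only [lintegral_const_mul _ (hmeas _), lintegral_const, measure_univ, mul_one]
    _ ≤ ENNReal.ofReal (4 * K ^ 2) * (ENNReal.ofReal (radSq y) +
          ∑' l : ℕ, 2⁻¹ ^ l * ENNReal.ofReal (c * radSq y)) := by
        gcongr ENNReal.ofReal (4 * K ^ 2) * (_ + ?_)
        exact ENNReal.tsum_le_tsum hlevel
    _ = ENNReal.ofReal (4 * K ^ 2 * (1 + 2 * c) * radSq y) := by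
        have hr := radSq_nonneg y
        rw [ENNReal.tsum_mul_right, ENNReal.tsum_geometric, ENNReal.one_sub_inv_two, inv_inv,
          show 4 * K ^ 2 * (1 + 2 * c) * radSq y =
            4 * K ^ 2 * (radSq y + 2 * (c * radSq y)) by ring,
          ENNReal.ofReal_mul (p := 4 * K ^ 2) (by positivity),
          ENNReal.ofReal_add hr (by positivity),
          ENNReal.ofReal_mul (p := 2) (by norm_num), ENNReal.ofReal_ofNat]

end GaussianRademacher

/-! ### Rotation invariance and `2`-summing operators -/

section Rotation

open ProbabilityTheory InnerProductSpace
open scoped RealInnerProductSpace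

variable {κ κ' X V : Type*} [Fintype κ] [Fintype κ'] [NormedAddCommGroup X] [NormedSpace ℝ X]
  [NormedAddCommGroup V] [InnerProductSpace ℝ V] [FiniteDimensional ℝ V] [MeasurableSpace V]
  [BorelSpace V]

theorem charFun_map_gaussPi (v : κ → V) (t : V) :
    charFun ((gaussPi κ).map fun g => ∑ k, g k • v k) t =
      Complex.exp (-((∑ k, ⟪v k, t⟫ ^ 2 : ℝ) : ℂ) / 2) := by
  have hinner (g : κ → ℝ) : ⟪∑ k, g k • v k, t⟫ =
      ⟪WithLp.toLp 2 g, (WithLp.toLp 2 fun k => ⟪v k, t⟫ : EuclideanSpace ℝ κ)⟫ := by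
    simp [sum_inner, real_inner_smul_left, PiLp.inner_apply, mul_comm]
  have hstd := charFun_stdGaussian (WithLp.toLp 2 fun k => ⟪v k, t⟫ : EuclideanSpace ℝ κ)
  have hmeas : Measurable fun g : κ → ℝ => ∑ k, g k • v k := by fun_prop
  rw [← map_pi_eq_stdGaussian, charFun_apply, integral_map (by fun_prop) (by fun_prop),
    ← Complex.ofReal_pow, EuclideanSpace.real_norm_sq_eq] at hstd
  rw [charFun_apply, integral_map hmeas.aemeasurable (by fun_prop)]
  simpa only [hinner, gaussPi] using hstd

theorem gaussSq_comp_eq_lintegral_map (w : V →ₗ[ℝ] X) (v : κ → V) : gaussSq (fun k => w (v k)) =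
    ∫⁻ x, ENNReal.ofReal (‖w x‖ ^ 2) ∂(gaussPi κ).map fun g => ∑ k, g k • v k := by
  have hF : Measurable fun x : V => ENNReal.ofReal (‖w x‖ ^ 2) :=
    (ENNReal.continuous_ofReal.comp
      ((LinearMap.continuous_of_finiteDimensional w).norm.pow 2)).measurable
  rw [lintegral_map hF (by fun_prop)]
  simp [gaussSq]

/-- The law of `∑ g_k v_k` only depends on its covariance form `t ↦ ∑ ⟪v_k, t⟫²`. -/
theorem gaussSq_comp_congr (w : V →ₗ[ℝ] X) (v : κ → V) (v' : κ' → V)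
    (h : ∀ t, ∑ k, ⟪v k, t⟫ ^ 2 = ∑ k, ⟪v' k, t⟫ ^ 2) :
    gaussSq (fun k => w (v k)) = gaussSq (fun k => w (v' k)) := by
  have h1 : IsProbabilityMeasure ((gaussPi κ).map fun g => ∑ k, g k • v k) :=
    Measure.isProbabilityMeasure_map (Measurable.aemeasurable (by fun_prop))
  have h2 : IsProbabilityMeasure ((gaussPi κ').map fun g => ∑ k, g k • v' k) :=
    Measure.isProbabilityMeasure_map (Measurable.aemeasurable (by fun_prop))
  rw [gaussSq_comp_eq_lintegral_map, gaussSq_comp_eq_lintegral_map]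
  congr 1
  refine Measure.ext_of_charFun (funext fun t => ?_)
  rw [charFun_map_gaussPi, charFun_map_gaussPi, h]

/-- The comparison of Gaussian averages with ordered covariances. The smaller family `v` is
completed to a family with covariance `Λ ‖t‖²`, in two ways which differ by the sign of the added
vectors. -/
theorem gaussSq_comp_le (w : V →ₗ[ℝ] X) (b : OrthonormalBasis κ' ℝ V) {N : ℕ} (v : Fin N → V)
    {Λ : ℝ} (hΛ : 0 ≤ Λ) (h : ∀ t, ∑ k, ⟪v k, t⟫ ^ 2 ≤ Λ * ‖t‖ ^ 2) :
    gaussSq (fun k => w (v k)) ≤ ENNReal.ofReal Λ * gaussSq (fun j => w (b j)) := by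
  -- `u` is obtained by writing the positive operator `Λ - ∑ v_k ⊗ v_k` as a sum of squares
  have hpos : (Λ • (1 : V →L[ℝ] V) - ∑ k, rankOne ℝ (v k) (v k)).IsPositive := by
    rw [ContinuousLinearMap.isPositive_def']
    refine ⟨?_, fun t => ?_⟩
    · refine ((IsSelfAdjoint.all Λ).smul (IsSelfAdjoint.one _)).sub ?_
      exact isSelfAdjoint_sum _ fun k _ => (isPositive_rankOne_self (v k)).isSelfAdjoint
    · have := h t
      simp only [ContinuousLinearMap.reApplyInnerSelf_apply, sub_apply,
        smul_apply, one_apply_eq_self,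
        sum_apply, rankOne_apply, inner_sub_left, real_inner_smul_left,
        sum_inner, real_inner_self_eq_norm_sq, RCLike.re_to_real]
      simpa only [sub_nonneg, ← pow_two] using this
  obtain ⟨n, u, hu⟩ := ContinuousLinearMap.isPositive_iff_eq_sum_rankOne.1 hpos
  have hcomp (t : V) : ∑ k, ⟪v k, t⟫ ^ 2 + ∑ i, ⟪u i, t⟫ ^ 2 = Λ * ‖t‖ ^ 2 := by
    have := congrArg (fun T : V →L[ℝ] V => ⟪T t, t⟫) hu
    simp only [sub_apply,
        smul_apply, one_apply_eq_self,
        sum_apply, rankOne_apply, inner_sub_left, real_inner_smul_left,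
        sum_inner, real_inner_self_eq_norm_sq, ← pow_two] at this
    linarith
  have hb (t : V) : ∑ j, ⟪Real.sqrt Λ • b j, t⟫ ^ 2 = Λ * ‖t‖ ^ 2 := by
    simp only [real_inner_smul_left, mul_pow, Real.sq_sqrt hΛ, ← Finset.mul_sum,
      b.sum_sq_inner_right]
  have hscale : gaussSq (fun j => w (Real.sqrt Λ • b j)) =
      ENNReal.ofReal Λ * gaussSq (fun j => w (b j)) := by
    unfold gaussSq
    rw [← lintegral_const_mul' _ _ ENNReal.ofReal_ne_top]
    refine lintegral_congr fun g => ?_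
    rw [← ENNReal.ofReal_mul hΛ]
    simp only [map_smul, smul_comm _ (Real.sqrt Λ), ← Finset.smul_sum]
    rw [norm_smul, mul_pow, Real.norm_eq_abs, sq_abs, Real.sq_sqrt hΛ]
  have h1 : gaussSq (fun k => w (Sum.elim v u k)) =
      ENNReal.ofReal Λ * gaussSq (fun j => w (b j)) := by
    rw [← hscale]
    exact gaussSq_comp_congr w _ _ fun t => by simp [Fintype.sum_sum_type, hcomp, hb]
  have h2 : gaussSq (fun k => w (Sum.elim v (fun i => -u i) k)) =
      ENNReal.ofReal Λ * gaussSq (fun j => w (b j)) := by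
    rw [← hscale]
    exact gaussSq_comp_congr w _ _ fun t => by simp [Fintype.sum_sum_type, hcomp, hb]
  have h0 : gaussSq (fun k => w (v k)) =
      gaussSq (fun k => w (Sum.elim v (fun _ : Fin n => (0 : V)) k)) :=
    gaussSq_comp_congr w _ _ fun t => by simp [Fintype.sum_sum_type]
  have hpt (g : Fin N ⊕ Fin n → ℝ) :
      ENNReal.ofReal (‖∑ k, g k • w (Sum.elim v (fun _ : Fin n => (0 : V)) k)‖ ^ 2) ≤
        2⁻¹ * (ENNReal.ofReal (‖∑ k, g k • w (Sum.elim v u k)‖ ^ 2) +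
          ENNReal.ofReal (‖∑ k, g k • w (Sum.elim v (fun i => -u i) k)‖ ^ 2)) := by
    rw [← ENNReal.ofReal_add (by positivity) (by positivity), ← ENNReal.ofReal_ofNat 2,
      ← ENNReal.ofReal_inv_of_pos (by norm_num), ← ENNReal.ofReal_mul (by norm_num)]
    refine ENNReal.ofReal_le_ofReal ?_
    simp only [Fintype.sum_sum_type, Sum.elim_inl, Sum.elim_inr, map_zero, smul_zero,
      Finset.sum_const_zero, add_zero, map_neg, smul_neg, Finset.sum_neg_distrib]
    set p := ∑ k, g (Sum.inl k) • w (v k)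
    set q := ∑ i, g (Sum.inr i) • w (u i)
    have htri : 2 * ‖p‖ ≤ ‖p + q‖ + ‖p + -q‖ := by
      calc 2 * ‖p‖ = ‖(p + q) + (p + -q)‖ := by
            rw [show (p + q) + (p + -q) = (2 : ℝ) • p by module, norm_smul]
            norm_num
        _ ≤ _ := norm_add_le _ _
    nlinarith [norm_nonneg p, sq_nonneg (‖p + q‖ - ‖p + -q‖)]
  have hmeas {κ₀ : Type} [Fintype κ₀] (z : κ₀ → X) :
      Measurable fun g : κ₀ → ℝ => ENNReal.ofReal (‖∑ k, g k • z k‖ ^ 2) :=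
    (ENNReal.continuous_ofReal.comp (by fun_prop)).measurable
  calc gaussSq (fun k => w (v k))
      ≤ ∫⁻ g, 2⁻¹ * (ENNReal.ofReal (‖∑ k, g k • w (Sum.elim v u k)‖ ^ 2) +
          ENNReal.ofReal (‖∑ k, g k • w (Sum.elim v (fun i => -u i) k)‖ ^ 2))
            ∂gaussPi (Fin N ⊕ Fin n) := by
        rw [h0]
        exact lintegral_mono hpt
    _ = 2⁻¹ * (gaussSq (fun k => w (Sum.elim v u k)) +
          gaussSq (fun k => w (Sum.elim v (fun i => -u i) k))) := by
        rw [lintegral_const_mul' _ _ (by simp), lintegral_add_left (hmeas _)]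
        rfl
    _ = ENNReal.ofReal Λ * gaussSq (fun j => w (b j)) := by
        rw [h1, h2, ← two_mul, ← mul_assoc, ENNReal.inv_mul_cancel (by simp) (by simp), one_mul]

/-- In a space of cotype `2`, an operator from a Euclidean space is `2`-summing, with constant
controlled by the Rademacher average of the images of an orthonormal basis. -/
theorem exists_sum_norm_sq_le_radSq {c : ℝ} (hc0 : 0 ≤ c)
    (hc : ∀ (N : ℕ) (x : Fin N → X), ∑ k, ‖x k‖ ^ 2 ≤ c * radSq x) :
    ∃ D : ℝ, 0 < D ∧ ∀ (m : ℕ) (w : EuclideanSpace ℝ (Fin m) →ₗ[ℝ] X) (N : ℕ)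
      (v : Fin N → EuclideanSpace ℝ (Fin m)), ∑ k, ‖w (v k)‖ ^ 2 ≤
        D * radSq (fun j => w (EuclideanSpace.basisFun (Fin m) ℝ j)) *
          ‖∑ k, rankOne ℝ (v k) (v k)‖ := by
  obtain ⟨D, hD, hgauss⟩ := exists_gaussSq_le_radSq hc0 hc
  refine ⟨(c + 1) * D, by positivity, fun m w N v => ?_⟩
  set b := EuclideanSpace.basisFun (Fin m) ℝ
  set Q := ∑ k, rankOne ℝ (v k) (v k)
  have hv (t : EuclideanSpace ℝ (Fin m)) : ∑ k, ⟪v k, t⟫ ^ 2 ≤ ‖Q‖ * ‖t‖ ^ 2 := by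
    calc ∑ k, ⟪v k, t⟫ ^ 2 = ⟪Q t, t⟫ := by
          simp [Q, sum_inner, real_inner_smul_left, pow_two]
      _ ≤ ‖Q t‖ * ‖t‖ := real_inner_le_norm _ _
      _ ≤ ‖Q‖ * ‖t‖ * ‖t‖ := by
          gcongr
          exact Q.le_opNorm t
      _ = ‖Q‖ * ‖t‖ ^ 2 := by ring
  have hr := radSq_nonneg fun j => w (b j)
  have h := calc
    ENNReal.ofReal (∑ k, ‖w (v k)‖ ^ 2) ≤ ENNReal.ofReal c * gaussSq fun k => w (v k) :=
        sum_norm_sq_le_gaussSq hc0 hc _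
    _ ≤ ENNReal.ofReal c * (ENNReal.ofReal ‖Q‖ * ENNReal.ofReal (D * radSq fun j => w (b j))) := by
        gcongr
        refine (gaussSq_comp_le w b v (norm_nonneg Q) hv).trans ?_
        gcongr
        exact hgauss m _
    _ = ENNReal.ofReal (c * (‖Q‖ * (D * radSq fun j => w (b j)))) := by
        rw [← ENNReal.ofReal_mul (norm_nonneg _), ← ENNReal.ofReal_mul hc0]
  refine ((ENNReal.ofReal_le_ofReal_iff (by positivity)).1 h).trans ?_
  have : 0 ≤ ‖Q‖ * (D * radSq fun j => w (b j)) := by positivity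
  linarith

end Rotation

/-! ### A cube position for `2`-summing operators -/

section Pietsch

open InnerProductSpace
open scoped RealInnerProductSpace

variable {X V : Type*} [NormedAddCommGroup X] [NormedSpace ℝ X] [NormedAddCommGroup V]
  [InnerProductSpace ℝ V] [FiniteDimensional ℝ V] {m : ℕ}

/-- A `2`-summing operator `w` on a Euclidean space is bounded on the vertices of a suitably
rotated cube, by its `2`-summing constant. A functional `f` separating a ball of operators from the
convex hull of the `v ⊗ v` with `‖w v‖ = 1` dominates `‖w v‖²` by the quadratic form
`v ↦ f (v ⊗ v)`; in an orthonormal basis of eigenvectors of this form, it takes the value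
`f (id)`, its trace, at all the vertices. -/
theorem exists_orthonormalBasis_norm_sum_le (hrank : Module.finrank ℝ V = m) (w : V →ₗ[ℝ] X)
    {M : ℝ} (hM : 0 < M) (hw : ∀ (N : ℕ) (v : Fin N → V),
      ∑ k, ‖w (v k)‖ ^ 2 ≤ M * ‖∑ k, rankOne ℝ (v k) (v k)‖) :
    ∃ u : OrthonormalBasis (Fin m) ℝ V,
      ∀ η : Fin m → ℝ, (∀ k, |η k| = 1) → ‖w (∑ k, η k • u k)‖ ^ 2 ≤ M := by
  let S : Set (V →L[ℝ] V) := {Q | ∃ v : V, ‖w v‖ = 1 ∧ rankOne ℝ v v = Q}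
  have hdisj : Disjoint (Metric.ball (0 : V →L[ℝ] V) M⁻¹) (convexHull ℝ S) := by
    rw [Set.disjoint_left]
    intro Q hQ hS
    obtain ⟨ι, _, a, z, ha0, ha1, hz, rfl⟩ := mem_convexHull_iff_exists_fintype.1 hS
    choose v hv hvz using hz
    let e := Fintype.equivFin ι
    have h := hw _ fun k => Real.sqrt (a (e.symm k)) • v (e.symm k)
    have h1 : ∑ k, ‖w (Real.sqrt (a (e.symm k)) • v (e.symm k))‖ ^ 2 = 1 := by
      rw [e.symm.sum_comp fun i => ‖w (Real.sqrt (a i) • v i)‖ ^ 2, ← ha1]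
      refine Finset.sum_congr rfl fun i _ => ?_
      rw [map_smul, norm_smul, hv, mul_one, Real.norm_eq_abs, sq_abs, Real.sq_sqrt (ha0 i)]
    have h2 : ∑ k, rankOne ℝ (Real.sqrt (a (e.symm k)) • v (e.symm k))
        (Real.sqrt (a (e.symm k)) • v (e.symm k)) = ∑ i, a i • z i := by
      rw [e.symm.sum_comp fun i => rankOne ℝ (Real.sqrt (a i) • v i) (Real.sqrt (a i) • v i)]
      refine Finset.sum_congr rfl fun i _ => ?_
      rw [← hvz]
      ext1 x
      simp only [rankOne_apply, real_inner_smul_left, smul_apply, smul_smul]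
      congr 1
      linear_combination ⟪v i, x⟫ * Real.mul_self_sqrt (ha0 i)
    rw [h1, h2] at h
    rw [mem_ball_zero_iff, lt_inv_comm₀ (norm_pos_iff.2 ?_) hM] at hQ
    · have hpos : 0 < ‖∑ i, a i • z i‖ := by
        by_contra hcon
        have : ‖∑ i, a i • z i‖ = 0 := le_antisymm (not_lt.1 hcon) (norm_nonneg _)
        rw [this] at h
        norm_num at h
      have := (lt_inv_comm₀ hM hpos).1 hQ
      have := mul_lt_mul_of_pos_left this hM
      rw [mul_inv_cancel₀ hM.ne'] at this
      linarith
    · rintro h0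
      rw [h0] at h
      norm_num at h
  obtain ⟨f, s, hfs, hsf⟩ := geometric_hahn_banach_open (convex_ball (0 : V →L[ℝ] V) M⁻¹)
    Metric.isOpen_ball (convex_convexHull ℝ S) hdisj
  have hs : 0 < s := by simpa using hfs 0 (by simpa using hM)
  -- the multiples `r • 1` with `r < M⁻¹` lie in the ball
  have htrace : f 1 ≤ M * s := by
    by_contra! hcon
    have hf1 : 0 < f 1 := (by positivity : 0 < M * s).trans hcon
    have hlt : s / f 1 < M⁻¹ := by
      rw [div_lt_iff₀ hf1, ← div_eq_inv_mul, lt_div_iff₀ hM]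
      linarith
    have := hfs ((s / f 1) • 1) (by
      rw [mem_ball_zero_iff, norm_smul, Real.norm_of_nonneg (by positivity)]
      refine lt_of_le_of_lt ?_ hlt
      exact mul_le_of_le_one_right (by positivity) ContinuousLinearMap.norm_id_le)
    rw [map_smul, smul_eq_mul, div_mul_cancel₀ _ hf1.ne'] at this
    exact lt_irrefl _ this
  have hdom (v : V) (hv : w v ≠ 0) : s * ‖w v‖ ^ 2 ≤ f (rankOne ℝ v v) := by
    have hn : 0 < ‖w v‖ := norm_pos_iff.2 hv
    have h := hsf (rankOne ℝ (‖w v‖⁻¹ • v) (‖w v‖⁻¹ • v)) (subset_convexHull ℝ S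
      ⟨_, by rw [map_smul, norm_smul, norm_inv, norm_norm, inv_mul_cancel₀ hn.ne'], rfl⟩)
    have hsc : rankOne ℝ (‖w v‖⁻¹ • v) (‖w v‖⁻¹ • v) = (‖w v‖ ^ 2)⁻¹ • rankOne ℝ v v := by
      ext1 x
      simp only [rankOne_apply, real_inner_smul_left, smul_apply, smul_smul]
      congr 1
      ring
    rw [hsc, map_smul, smul_eq_mul, ← div_eq_inv_mul, le_div_iff₀ (by positivity)] at h
    exact h
  let e := stdOrthonormalBasis ℝ V
  let B : V →ₗ[ℝ] V →ₗ[ℝ] ℝ := LinearMap.mk₂ ℝ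
    (fun x y => (f (rankOne ℝ x y) + f (rankOne ℝ y x)) / 2)
    (fun x x' y => by simp only [map_add, add_apply]; ring)
    (fun a x y => by simp only [map_smul, smul_apply, smul_eq_mul]; ring)
    (fun x y y' => by simp only [map_add, add_apply]; ring)
    (fun a x y => by simp only [map_smul, smul_apply, smul_eq_mul]; ring)
  have hBsymm (x y : V) : B x y = B y x := by
    simp only [B, LinearMap.mk₂_apply]
    ring
  have hBself (x : V) : B x x = f (rankOne ℝ x x) := by
    simp only [B, LinearMap.mk₂_apply]
    ring
  -- the symmetric operator representing the symmetrised form `B`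
  let T : V →ₗ[ℝ] V := ∑ i, (B (e i)).smulRight (e i)
  have hT (x y : V) : ⟪T x, y⟫ = B x y := by
    conv_rhs => rw [hBsymm, ← e.sum_repr' y]
    simp [T, sum_inner, real_inner_smul_left, mul_comm]
  have hTsymm : T.IsSymmetric := fun x y => by
    rw [hT, real_inner_comm, hT, hBsymm]
  let u := hTsymm.eigenvectorBasis hrank
  refine ⟨u, fun η hη => ?_⟩
  have hη2 (k : Fin m) : η k * η k = 1 := by
    rw [← pow_two, ← sq_abs, hη, one_pow]
  have hvertex : f (rankOne ℝ (∑ k, η k • u k) (∑ k, η k • u k)) = f 1 := by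
    have hT1 : T (∑ k, η k • u k) = ∑ k, (η k * hTsymm.eigenvalues hrank k) • u k := by
      simp only [map_sum, map_smul]
      refine Finset.sum_congr rfl fun k _ => ?_
      rw [mul_smul]
      congr 1
      exact hTsymm.apply_eigenvectorBasis hrank k
    have h1 : f (rankOne ℝ (∑ k, η k • u k) (∑ k, η k • u k)) =
        ∑ k, hTsymm.eigenvalues hrank k := by
      rw [← hBself, ← hT, hT1, u.orthonormal.inner_sum]
      refine Finset.sum_congr rfl fun k _ => ?_
      rw [conj_trivial, mul_right_comm, hη2, one_mul]
    rw [h1, show (1 : V →L[ℝ] V) = ∑ k, rankOne ℝ (u k) (u k) from u.sum_rankOne_eq_id.symm,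
      map_sum]
    refine Finset.sum_congr rfl fun k _ => ?_
    rw [← hBself, ← hT, hTsymm.apply_eigenvectorBasis hrank k]
    simp [real_inner_smul_left, u]
  by_cases h0 : w (∑ k, η k • u k) = 0
  · rw [h0]
    simpa using hM.le
  · have h := (hdom _ h0).trans (hvertex.le.trans htrace)
    rw [mul_comm] at h
    exact le_of_mul_le_mul_right h hs

end Pietsch

/-! ### The norms of finite families -/

section Norms

variable {𝕜 : Type*} [RCLike 𝕜]

theorem ellNorm_one_eq_sum {ι F : Type*} [Fintype ι] [NormedAddCommGroup F] (x : ι → F) :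
    ellNorm 1 x = ENNReal.ofReal (∑ j, ‖x j‖) := by
  simp [ellNorm, tsum_fintype, ENNReal.ofReal_sum_of_nonneg]

theorem ellNorm_two_eq {ι F : Type*} [Fintype ι] [NormedAddCommGroup F] (x : ι → F) :
    ellNorm 2 x = ENNReal.ofReal (Real.sqrt (∑ j, ‖x j‖ ^ 2)) := by
  have h : (∑ j, ‖x j‖ₑ ^ (2 : ℝ)) = ENNReal.ofReal (∑ j, ‖x j‖ ^ 2) := by
    rw [ENNReal.ofReal_sum_of_nonneg fun _ _ => by positivity]
    refine Finset.sum_congr rfl fun j _ => ?_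
    rw [ENNReal.ofReal_pow (norm_nonneg _), ofReal_norm, ENNReal.rpow_ofNat]
  rw [ellNorm, tsum_fintype, h, ENNReal.ofReal_rpow_of_nonneg
    (Finset.sum_nonneg fun _ _ => by positivity) (by norm_num), Real.sqrt_eq_rpow]

variable {ι E : Type*} [Fintype ι] [NormedAddCommGroup E] [NormedSpace 𝕜 E]

theorem weakNorm_one_le {x : ι → E} {W : ℝ}
    (h : ∀ φ : StrongDual 𝕜 E, ‖φ‖ ≤ 1 → ∑ j, ‖φ (x j)‖ ≤ W) :
    weakNorm 𝕜 1 x ≤ ENNReal.ofReal W := by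
  refine iSup₂_le fun φ hφ => ?_
  rw [ellNorm_one_eq_sum]
  exact ENNReal.ofReal_le_ofReal (h φ hφ)

theorem weakNorm_two_le {x : ι → E} {W : ℝ} (hW : 0 ≤ W)
    (h : ∀ φ : StrongDual 𝕜 E, ‖φ‖ ≤ 1 → ∑ j, ‖φ (x j)‖ ^ 2 ≤ W ^ 2) :
    weakNorm 𝕜 2 x ≤ ENNReal.ofReal W := by
  refine iSup₂_le fun φ hφ => ?_
  rw [ellNorm_two_eq]
  exact ENNReal.ofReal_le_ofReal (Real.sqrt_le_iff.2 ⟨hW, h φ hφ⟩)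

theorem weakNorm_two_ne_top (x : ι → E) : weakNorm 𝕜 2 x ≠ ∞ := by
  refine ((weakNorm_two_le (W := Real.sqrt (∑ j, ‖x j‖ ^ 2)) (Real.sqrt_nonneg _)
    fun φ hφ => ?_).trans_lt ENNReal.ofReal_lt_top).ne
  rw [Real.sq_sqrt (Finset.sum_nonneg fun _ _ => by positivity)]
  gcongr with j
  exact φ.le_of_opNorm_le_of_le hφ le_rfl |>.trans_eq (one_mul _)

theorem sum_norm_sq_le_weakNorm (x : ι → E) {φ : StrongDual 𝕜 E} (hφ : ‖φ‖ ≤ 1) :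
    ∑ j, ‖φ (x j)‖ ^ 2 ≤ (weakNorm 𝕜 2 x).toReal ^ 2 := by
  have h : ellNorm 2 (fun j => φ (x j)) ≤ weakNorm 𝕜 2 x :=
    le_iSup₂ (f := fun (φ : StrongDual 𝕜 E) (_ : ‖φ‖ ≤ 1) => ellNorm 2 fun j => φ (x j)) φ hφ
  rw [ellNorm_two_eq, ENNReal.ofReal_le_iff_le_toReal (weakNorm_two_ne_top x)] at h
  exact (Real.sqrt_le_left ENNReal.toReal_nonneg).1 h

theorem eLpNorm_radSum_eq {X : Type*} [NormedAddCommGroup X] [NormedSpace 𝕜 X] [NormedSpace ℝ X]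
    [IsScalarTower ℝ 𝕜 X] {m : ℕ} (y : Fin m → X) :
    eLpNorm (radSum 𝕜 y) 2 (volume.restrict (Set.Icc (0 : ℝ) 1)) =
      ENNReal.ofReal (Real.sqrt (radSq y)) := by
  have hsum (t : ℝ) : radSum 𝕜 y t = ∑ j : Fin m, rademacher (j + 1) t • y j := by
    simp only [radSum, RCLike.real_smul_eq_coe_smul (K := 𝕜)]
  have h := eLpNorm_nnreal_pow_eq_lintegral (f := radSum 𝕜 y) (p := 2)
    (μ := volume.restrict (Set.Icc (0 : ℝ) 1)) (by norm_num)
  simp only [NNReal.coe_ofNat, ENNReal.coe_ofNat, ENNReal.rpow_ofNat] at h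
  rw [← setLIntegral_congr Ioo_ae_eq_Icc] at h
  simp only [hsum] at h
  rw [setLIntegral_rademacher m fun s => ‖∑ j, s j • y j‖ₑ ^ 2] at h
  have h2 : (∑ ε : Fin m → ℤˣ, ‖∑ j, ((ε j : ℤ) : ℝ) • y j‖ₑ ^ 2) / 2 ^ m =
      ENNReal.ofReal (Real.sqrt (radSq y)) ^ 2 := by
    rw [← ENNReal.ofReal_pow (Real.sqrt_nonneg _), Real.sq_sqrt (radSq_nonneg y), radSq,
      ENNReal.ofReal_div_of_pos (by positivity),
      ENNReal.ofReal_sum_of_nonneg fun _ _ => by positivity, ENNReal.ofReal_pow (by norm_num),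
      ENNReal.ofReal_ofNat, Fintype.card_fin]
    congr 1
    refine Finset.sum_congr rfl fun ε _ => ?_
    rw [ENNReal.ofReal_pow (norm_nonneg _), ofReal_norm]
  rw [h2] at h
  exact (ENNReal.pow_right_strictMono two_ne_zero).injective h

theorem exists_cotype_radSq {X : Type*} [NormedAddCommGroup X] [NormedSpace 𝕜 X]
    [NormedSpace ℝ X] [IsScalarTower ℝ 𝕜 X] (h : HasCotype 𝕜 X 2) :
    ∃ c : ℝ, 0 ≤ c ∧ ∀ (N : ℕ) (x : Fin N → X), ∑ k, ‖x k‖ ^ 2 ≤ c * radSq x := by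
  obtain ⟨C, hC⟩ := h
  refine ⟨C ^ 2, by positivity, fun N x => ?_⟩
  have h := hC N x
  rw [ellNorm_two_eq, eLpNorm_radSum_eq, ← ENNReal.ofReal_coe_nnreal,
    ← ENNReal.ofReal_mul C.coe_nonneg, ENNReal.ofReal_le_ofReal_iff (by positivity),
    Real.sqrt_le_left (by positivity), mul_pow, Real.sq_sqrt (radSq_nonneg x)] at h
  exact h

end Norms

/-! ### Rademacher averages in a dual space -/

section Duality

variable {𝕜 : Type*} [RCLike 𝕜]

theorem sum_signs_mul_eq_zero {m : ℕ} {i j : Fin m} (hij : i ≠ j) :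
    ∑ ε : Fin m → ℤˣ, ((ε i : ℤ) : 𝕜) * ((ε j : ℤ) : 𝕜) = 0 := by
  have h := Equiv.sum_comp (Equiv.mulLeft (Function.update (1 : Fin m → ℤˣ) i (-1)))
    fun ε : Fin m → ℤˣ => ((ε i : ℤ) : 𝕜) * ((ε j : ℤ) : 𝕜)
  simp only [Equiv.coe_mulLeft, Pi.mul_apply, Function.update_self,
    Function.update_of_ne hij.symm, Pi.one_apply, one_mul, Units.val_neg,
    Int.cast_neg, neg_mul, Finset.sum_neg_distrib] at h
  exact CharZero.neg_eq_self_iff.1 h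

/-- Bessel's inequality for the coordinate functions on the space of signs. -/
theorem sum_norm_sq_rademacher_coeff_le {m : ℕ} (F : (Fin m → ℤˣ) → 𝕜) :
    ∑ j, ‖((2 : 𝕜) ^ m)⁻¹ * ∑ ε, ((ε j : ℤ) : 𝕜) * F ε‖ ^ 2 ≤ (∑ ε, ‖F ε‖ ^ 2) / 2 ^ m := by
  let s : ℝ := Real.sqrt (2 ^ m)
  have hs : s ^ 2 = 2 ^ m := Real.sq_sqrt (by positivity)
  have hs0 : s ≠ 0 := by positivity
  have hsK : ((s : 𝕜)) ^ 2 = 2 ^ m := by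
    rw [← RCLike.ofReal_pow, hs]
    push_cast
    rfl
  have hsK0 : (s : 𝕜) ≠ 0 := by simpa using hs0
  let v (j : Fin m) : EuclideanSpace 𝕜 (Fin m → ℤˣ) :=
    WithLp.toLp 2 fun ε => (s : 𝕜)⁻¹ * ((ε j : ℤ) : 𝕜)
  have hinner (j : Fin m) (G : (Fin m → ℤˣ) → 𝕜) :
      inner 𝕜 (v j) (WithLp.toLp 2 G) = (s : 𝕜)⁻¹ * ∑ ε, ((ε j : ℤ) : 𝕜) * G ε := by
    simp only [v, PiLp.inner_apply, RCLike.inner_apply, map_mul, map_inv₀, RCLike.conj_ofReal,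
      map_intCast, Finset.mul_sum]
    exact Finset.sum_congr rfl fun ε _ => by ring
  have hv : Orthonormal 𝕜 v := by
    rw [orthonormal_iff_ite]
    intro i j
    rw [hinner]
    have hsplit : ∑ ε : Fin m → ℤˣ, ((ε i : ℤ) : 𝕜) * ((s : 𝕜)⁻¹ * ((ε j : ℤ) : 𝕜)) =
        (s : 𝕜)⁻¹ * ∑ ε : Fin m → ℤˣ, ((ε i : ℤ) : 𝕜) * ((ε j : ℤ) : 𝕜) := by
      rw [Finset.mul_sum]
      exact Finset.sum_congr rfl fun ε _ => by ring
    rw [hsplit]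
    split_ifs with hij
    · subst hij
      have hone (ε : Fin m → ℤˣ) : ((ε i : ℤ) : 𝕜) * ((ε i : ℤ) : 𝕜) = 1 := by
        rcases Int.units_eq_one_or (ε i) with h | h <;> simp [h]
      simp only [hone, Finset.sum_const, Finset.card_univ, nsmul_eq_mul, mul_one]
      have : ((Fintype.card (Fin m → ℤˣ) : ℕ) : 𝕜) = 2 ^ m := by simp
      rw [this, ← hsK]
      field_simp
    · rw [sum_signs_mul_eq_zero hij]
      simp
  have hbessel := hv.sum_inner_products_le (s := Finset.univ) (WithLp.toLp 2 F)
  rw [EuclideanSpace.norm_sq_eq] at hbessel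
  rw [le_div_iff₀ (by positivity), mul_comm, Finset.mul_sum]
  refine le_trans (le_of_eq (Finset.sum_congr rfl fun j _ => ?_)) hbessel
  rw [hinner, norm_mul, norm_mul, mul_pow, mul_pow, ← hsK, norm_inv, norm_inv, norm_pow,
    RCLike.norm_ofReal, ← hs]
  field_simp
  rw [sq_abs, mul_comm]

variable {E : Type*} [NormedAddCommGroup E] [NormedSpace 𝕜 E]

theorem exists_apply_eq_ofReal_of_lt_one (f : StrongDual 𝕜 E) {θ : ℝ} (hθ : θ < 1) :
    ∃ (z : E) (r : ℝ), ‖z‖ ≤ ‖f‖ ∧ f z = r ∧ θ * ‖f‖ ^ 2 ≤ r := by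
  rcases eq_or_ne f 0 with rfl | hf
  · exact ⟨0, 0, by simp, by simp, by simp⟩
  have hf0 : 0 < ‖f‖ := norm_pos_iff.2 hf
  obtain ⟨x, hx1, hx⟩ := f.exists_lt_apply_of_lt_opNorm (r := max θ 0 * ‖f‖)
    (mul_lt_of_lt_one_left hf0 (max_lt hθ one_pos))
  have hfx : 0 < ‖f x‖ := lt_of_le_of_lt (by positivity) hx
  refine ⟨((‖f‖ : 𝕜) * (starRingEnd 𝕜 (f x) / (‖f x‖ : 𝕜))) • x, ‖f‖ * ‖f x‖, ?_, ?_, ?_⟩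
  · rw [norm_smul, norm_mul, norm_div, RCLike.norm_conj, RCLike.norm_ofReal, RCLike.norm_ofReal,
      abs_norm, abs_norm, div_self hfx.ne', mul_one]
    exact mul_le_of_le_one_right hf0.le hx1.le
  · have hne : (‖f x‖ : 𝕜) ≠ 0 := by simpa using hfx.ne'
    rw [map_smul, smul_eq_mul, mul_assoc, div_mul_eq_mul_div, RCLike.conj_mul, pow_two,
      mul_div_assoc, div_self hne, mul_one, RCLike.ofReal_mul]
  · have : θ * ‖f‖ ≤ ‖f x‖ :=
      (mul_le_mul_of_nonneg_right (le_max_left _ _) hf0.le).trans hx.le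
    nlinarith

/-- A family in a dual space which acts boundedly on weakly `2`-summable families has a bounded
Rademacher average: test against the Rademacher coefficients of a function on the space of signs
whose value at `ε` almost norms `∑ ε_j y_j`. -/
theorem radSq_le_of_forall_sum_le {m : ℕ} (y : Fin m → StrongDual 𝕜 E) {D : ℝ} (hD : 0 ≤ D)
    (h : ∀ z : Fin m → E,
      ENNReal.ofReal (∑ j, ‖y j (z j)‖) ≤ ENNReal.ofReal D * weakNorm 𝕜 2 z) :
    radSq y ≤ D ^ 2 := by
  have hr := radSq_nonneg y
  have key (θ : ℝ) (hθ : θ < 1) : θ * radSq y ≤ D * Real.sqrt (radSq y) := by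
    choose Z r hZ hfZ hrZ using fun ε : Fin m → ℤˣ =>
      exists_apply_eq_ofReal_of_lt_one (∑ j, ((ε j : ℤ) : ℝ) • y j) hθ
    let z (j : Fin m) : E := ((2 : 𝕜) ^ m)⁻¹ • ∑ ε : Fin m → ℤˣ, ((ε j : ℤ) : 𝕜) • Z ε
    have hweak : weakNorm 𝕜 2 z ≤ ENNReal.ofReal (Real.sqrt (radSq y)) := by
      refine weakNorm_two_le (Real.sqrt_nonneg _) fun φ hφ => ?_
      rw [Real.sq_sqrt hr]
      calc ∑ j, ‖φ (z j)‖ ^ 2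
          = ∑ j, ‖((2 : 𝕜) ^ m)⁻¹ * ∑ ε, ((ε j : ℤ) : 𝕜) * φ (Z ε)‖ ^ 2 := by
            simp only [z, map_smul, map_sum, smul_eq_mul]
        _ ≤ (∑ ε, ‖φ (Z ε)‖ ^ 2) / 2 ^ m := sum_norm_sq_rademacher_coeff_le _
        _ ≤ radSq y := by
            unfold radSq
            rw [Fintype.card_fin]
            gcongr with ε
            exact (φ.le_of_opNorm_le_of_le hφ (hZ ε)).trans_eq (one_mul _)
    have hval : ∑ j, y j (z j) = (((∑ ε, r ε) / 2 ^ m : ℝ) : 𝕜) := by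
      have h1 (ε : Fin m → ℤˣ) : ∑ j, ((ε j : ℤ) : 𝕜) * y j (Z ε) = r ε := by
        rw [← hfZ ε]
        simp [sum_apply, RCLike.real_smul_eq_coe_mul]
      simp only [z, map_smul, map_sum, smul_eq_mul]
      rw [← Finset.mul_sum, Finset.sum_comm]
      simp only [h1]
      push_cast
      rw [div_eq_inv_mul]
    have hlow : θ * radSq y ≤ ∑ j, ‖y j (z j)‖ := by
      calc θ * radSq y ≤ (∑ ε, r ε) / 2 ^ m := by
            unfold radSq
            rw [Fintype.card_fin, ← mul_div_assoc, Finset.mul_sum]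
            gcongr with ε
            exact hrZ ε
        _ ≤ ‖∑ j, y j (z j)‖ := by
            rw [hval, RCLike.norm_ofReal]
            exact le_abs_self _
        _ ≤ _ := norm_sum_le _ _
    have hup := (h z).trans (mul_le_mul_right hweak _)
    rw [← ENNReal.ofReal_mul hD, ENNReal.ofReal_le_ofReal_iff (by positivity)] at hup
    exact hlow.trans hup
  have hlim : radSq y ≤ D * Real.sqrt (radSq y) := by
    have hc : Filter.Tendsto (fun θ : ℝ => θ * radSq y) (nhdsWithin 1 (Set.Iio 1))
        (nhds (1 * radSq y)) :=
      ((continuous_id.mul continuous_const).tendsto 1).mono_left nhdsWithin_le_nhds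
    rw [one_mul] at hc
    exact le_of_tendsto hc (Filter.eventually_of_mem self_mem_nhdsWithin fun θ hθ => key θ hθ)
  have hsq := Real.sq_sqrt hr
  have hs0 := Real.sqrt_nonneg (radSq y)
  have : Real.sqrt (radSq y) ≤ D := by
    rcases hs0.eq_or_lt with h0 | h0
    · rw [← h0]
      exact hD
    · nlinarith
  nlinarith

end Duality

/-! ### Operators from GT-spaces into `ℓ_2` -/

section GTSpace

variable {𝕜 : Type*} [RCLike 𝕜]

/-- In a GT-space the `1`-summing constants of operators into `ℓ_2` are uniformly controlled by
their norms, by the uniform boundedness principle. -/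
theorem IsGTSpace.exists_uniform {X : Type*} [NormedAddCommGroup X] [NormedSpace 𝕜 X]
    (hX : IsGTSpace 𝕜 X) :
    ∃ K : ℝ, 0 ≤ K ∧ ∀ (u : X →L[𝕜] lp (fun _ : ℕ => 𝕜) 2) (m : ℕ) (x : Fin m → X) (W : ℝ),
      0 < W → (∀ φ : StrongDual 𝕜 X, ‖φ‖ ≤ 1 → ∑ j, ‖φ (x j)‖ ≤ W) →
        ∑ j, ‖u (x j)‖ ≤ K * ‖u‖ * W := by
  let H := lp (fun _ : ℕ => 𝕜) 2
  let I := {i : Σ m : ℕ, (Fin m → X) × (Fin m → StrongDual 𝕜 H) //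
    (∀ φ : StrongDual 𝕜 X, ‖φ‖ ≤ 1 → ∑ j, ‖φ (i.2.1 j)‖ ≤ 1) ∧ ∀ j, ‖i.2.2 j‖ ≤ 1}
  let g (i : I) : (X →L[𝕜] H) →L[𝕜] 𝕜 :=
    ∑ j, (i.1.2.2 j).comp (ContinuousLinearMap.apply 𝕜 H (i.1.2.1 j))
  have hg (i : I) (u : X →L[𝕜] H) : g i u = ∑ j, i.1.2.2 j (u (i.1.2.1 j)) := by
    simp [g, sum_apply]
  obtain ⟨K, hK⟩ := banach_steinhaus (g := g) fun u => by
    obtain ⟨C, -, hC⟩ := hX u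
    refine ⟨C, fun i => ?_⟩
    have h := (hC _ i.1.2.1).trans (mul_le_mul_right (weakNorm_one_le i.2.1) _)
    rw [ellNorm_one_eq_sum, ENNReal.ofReal_one, mul_one, ← ENNReal.ofReal_coe_nnreal,
      ENNReal.ofReal_le_ofReal_iff C.coe_nonneg] at h
    rw [hg]
    refine (norm_sum_le _ _).trans (le_trans ?_ h)
    gcongr with j
    exact ((i.1.2.2 j).le_of_opNorm_le_of_le (i.2.2 j) le_rfl).trans_eq (one_mul _)
  refine ⟨max K 0, le_max_right _ _, fun u m x W hW hx => ?_⟩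
  choose θ hθ hθu using fun j => exists_dual_vector'' 𝕜 (u (x j))
  have hW𝕜 : ‖((W⁻¹ : ℝ) : 𝕜)‖ = W⁻¹ := by
    rw [RCLike.norm_ofReal, abs_of_pos (inv_pos.2 hW)]
  let i : I := ⟨⟨m, fun j => ((W⁻¹ : ℝ) : 𝕜) • x j, θ⟩, fun φ hφ => by
    simp only [map_smul, norm_smul, hW𝕜, ← Finset.mul_sum]
    rw [← div_eq_inv_mul, div_le_one hW]
    exact hx φ hφ, hθ⟩
  have hi : g i u = ((W⁻¹ * ∑ j, ‖u (x j)‖ : ℝ) : 𝕜) := by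
    rw [hg]
    simp only [i, map_smul, smul_eq_mul, hθu]
    rw [← Finset.mul_sum]
    push_cast
    rfl
  have h := (g i).le_opNorm u
  rw [hi, RCLike.norm_ofReal, abs_of_nonneg (by positivity), ← div_eq_inv_mul,
    div_le_iff₀ hW] at h
  refine h.trans ?_
  gcongr
  exact (hK i).trans (le_max_left _ _)

variable {E : Type*} [NormedAddCommGroup E] [NormedSpace 𝕜 E]

/-- The operator `φ ↦ (φ z_j)_j` from the dual space to `ℓ_2`. -/
noncomputable def evalOp {m : ℕ} (z : Fin m → E) : StrongDual 𝕜 E →L[𝕜] lp (fun _ : ℕ => 𝕜) 2 :=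
  ∑ j : Fin m, (ContinuousLinearMap.apply 𝕜 𝕜 (z j)).smulRight (lp.single 2 (j : ℕ) (1 : 𝕜))

theorem norm_evalOp_apply_sq {m : ℕ} (z : Fin m → E) (φ : StrongDual 𝕜 E) :
    ‖evalOp z φ‖ ^ 2 = ∑ j, ‖φ (z j)‖ ^ 2 := by
  let f (k : ℕ) : 𝕜 := if h : k < m then φ (z ⟨k, h⟩) else 0
  have h : evalOp z φ = ∑ k ∈ Finset.range m, lp.single 2 k (f k) := by
    rw [Finset.sum_range]
    simp only [evalOp, sum_apply, ContinuousLinearMap.smulRight_apply,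
      ContinuousLinearMap.apply_apply]
    refine Finset.sum_congr rfl fun j _ => ?_
    rw [← lp.single_smul]
    simp [f]
  have h2 := lp.norm_sum_single (p := 2) (E := fun _ : ℕ => 𝕜) (by simp) f (Finset.range m)
  rw [← h, Finset.sum_range] at h2
  simpa [f] using h2

theorem norm_evalOp_le {m : ℕ} (z : Fin m → E) :
    ‖(evalOp z : StrongDual 𝕜 E →L[𝕜] lp (fun _ : ℕ => 𝕜) 2)‖ ≤ (weakNorm 𝕜 2 z).toReal := by
  refine ContinuousLinearMap.opNorm_le_of_unit_norm ENNReal.toReal_nonneg fun φ hφ => ?_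
  refine (sq_le_sq₀ (norm_nonneg _) ENNReal.toReal_nonneg).1 ?_
  rw [norm_evalOp_apply_sq]
  exact sum_norm_sq_le_weakNorm z hφ.le

/-- If `c_k = ∑_j u_k(j) y_j` for an orthonormal basis `u` at
whose cube the operator `e_j ↦ y_j` is bounded, then `(c_k)` is weakly `1`-summable, and
`∑ y_j (z_j) = ∑_k c_k (∑_j u_k(j) z_j)` is controlled by the norms of the images of the `c_k`
under `φ ↦ (φ z_j)_j`, an operator which is `1`-summing on a GT-space. -/
theorem exists_norm_sum_apply_le (hGT : IsGTSpace 𝕜 (StrongDual 𝕜 E))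
    (hcot : HasCotype 𝕜 (StrongDual 𝕜 E) 2) :
    ∃ K : ℝ, 0 ≤ K ∧ ∀ (m : ℕ) (y : Fin m → StrongDual 𝕜 E) (z : Fin m → E),
      ‖∑ j, y j (z j)‖ ≤ K * Real.sqrt (radSq y) * (weakNorm 𝕜 2 z).toReal := by
  obtain ⟨c, hc0, hc⟩ := exists_cotype_radSq hcot
  obtain ⟨D, hD, hsum⟩ := exists_sum_norm_sq_le_radSq hc0 hc
  obtain ⟨K, hK0, hK⟩ := hGT.exists_uniform
  refine ⟨2 * K * Real.sqrt D, by positivity, fun m y z => ?_⟩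
  set W := (weakNorm 𝕜 2 z).toReal
  have hW : 0 ≤ W := ENNReal.toReal_nonneg
  let e := EuclideanSpace.basisFun (Fin m) ℝ
  let w : EuclideanSpace ℝ (Fin m) →ₗ[ℝ] StrongDual 𝕜 E := e.toBasis.constr ℝ y
  have hwe (j : Fin m) : w (e j) = y j := by
    have h := e.toBasis.constr_basis ℝ y j
    rwa [e.coe_toBasis] at h
  have key (M : ℝ) (hM : D * radSq y < M) :
      ‖∑ j, y j (z j)‖ ≤ K * W * (2 * Real.sqrt M) := by
    have hr := radSq_nonneg y
    have hM0 : 0 < M := (by positivity : 0 ≤ D * radSq y).trans_lt hM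
    obtain ⟨u, hu⟩ := exists_orthonormalBasis_norm_sum_le
      (finrank_euclideanSpace_fin (n := m)) w hM0 fun N v => by
      refine (hsum m w N v).trans (mul_le_mul_of_nonneg_right ?_ (norm_nonneg _))
      simp only [e, hwe] at hM ⊢
      exact hM.le
    have hreal (ℓ : StrongDual 𝕜 E →ₗ[ℝ] ℝ) (hℓ : ∀ x, |ℓ x| ≤ ‖x‖) :
        ∑ k, |ℓ (w (u k))| ≤ Real.sqrt M := by
      let η (k : Fin m) : ℝ := if 0 ≤ ℓ (w (u k)) then 1 else -1
      have hη (k : Fin m) : |η k| = 1 := by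
        simp only [η]
        split_ifs <;> simp
      have hηℓ (k : Fin m) : |ℓ (w (u k))| = η k * ℓ (w (u k)) := by
        simp only [η]
        split_ifs with h
        · rw [abs_of_nonneg h, one_mul]
        · rw [abs_of_neg (not_le.1 h), neg_one_mul]
      calc ∑ k, |ℓ (w (u k))| = ℓ (w (∑ k, η k • u k)) := by
            simp only [hηℓ, map_sum, map_smul, smul_eq_mul]
        _ ≤ ‖w (∑ k, η k • u k)‖ := (le_abs_self _).trans (hℓ _)
        _ ≤ Real.sqrt M := Real.le_sqrt_of_sq_le (hu η hη)
    have hweak (φ : StrongDual 𝕜 (StrongDual 𝕜 E)) (hφ : ‖φ‖ ≤ 1) :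
        ∑ k, ‖φ (w (u k))‖ ≤ 2 * Real.sqrt M := by
      have hφx (x : StrongDual 𝕜 E) : ‖φ x‖ ≤ ‖x‖ :=
        (φ.le_of_opNorm_le_of_le hφ le_rfl).trans_eq (one_mul _)
      let φR : StrongDual 𝕜 E →ₗ[ℝ] 𝕜 := φ.toLinearMap.restrictScalars ℝ
      have h1 := hreal (RCLike.reLm ∘ₗ φR) fun x => (RCLike.abs_re_le_norm _).trans (hφx x)
      have h2 := hreal (RCLike.imLm ∘ₗ φR) fun x => (RCLike.abs_im_le_norm _).trans (hφx x)
      calc ∑ k, ‖φ (w (u k))‖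
          ≤ ∑ k, (|RCLike.re (φ (w (u k)))| + |RCLike.im (φ (w (u k)))|) := by
            gcongr with k
            refine (sq_le_sq₀ (norm_nonneg _) (by positivity)).1 ?_
            rw [RCLike.norm_sq_eq_def, add_sq, sq_abs, sq_abs]
            have : 0 ≤ 2 * |RCLike.re (φ (w (u k)))| * |RCLike.im (φ (w (u k)))| := by positivity
            linarith
        _ ≤ Real.sqrt M + Real.sqrt M := by
            rw [Finset.sum_add_distrib]
            exact add_le_add h1 h2
        _ = 2 * Real.sqrt M := by ring
    have hexp (j : Fin m) : y j = ∑ k, (u k j) • w (u k) := by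
      conv_lhs => rw [← hwe j, ← u.sum_repr' (e j)]
      simp [e, EuclideanSpace.inner_single_right]
    calc ‖∑ j, y j (z j)‖ = ‖∑ k, ∑ j, (u k j) • w (u k) (z j)‖ := by
          rw [Finset.sum_comm]
          congr 1
          refine Finset.sum_congr rfl fun j _ => ?_
          conv_lhs => rw [hexp j]
          simp [sum_apply]
      _ ≤ ∑ k, ‖evalOp z (w (u k))‖ := by
          refine (norm_sum_le _ _).trans (Finset.sum_le_sum fun k _ => ?_)
          have hunit : ∑ j, (u k j) ^ 2 = 1 := by
            rw [← EuclideanSpace.real_norm_sq_eq, u.orthonormal.1 k, one_pow]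
          refine (sq_le_sq₀ (norm_nonneg _) (norm_nonneg _)).1 ?_
          rw [norm_evalOp_apply_sq]
          calc ‖∑ j, (u k j) • w (u k) (z j)‖ ^ 2
              ≤ (∑ j, |u k j| * ‖w (u k) (z j)‖) ^ 2 := by
                gcongr
                refine (norm_sum_le _ _).trans (le_of_eq ?_)
                exact Finset.sum_congr rfl fun j _ => by rw [norm_smul, Real.norm_eq_abs]
            _ ≤ (∑ j, |u k j| ^ 2) * ∑ j, ‖w (u k) (z j)‖ ^ 2 :=
                Finset.sum_mul_sq_le_sq_mul_sq _ _ _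
            _ = ∑ j, ‖w (u k) (z j)‖ ^ 2 := by
                simp only [sq_abs, hunit, one_mul]
      _ ≤ K * ‖(evalOp z : StrongDual 𝕜 E →L[𝕜] lp (fun _ : ℕ => 𝕜) 2)‖ * (2 * Real.sqrt M) :=
          hK _ m _ _ (by positivity) hweak
      _ ≤ K * W * (2 * Real.sqrt M) := by
          gcongr
          exact norm_evalOp_le z
  have hlim : Filter.Tendsto (fun M : ℝ => K * W * (2 * Real.sqrt M))
      (nhdsWithin (D * radSq y) (Set.Ioi (D * radSq y)))
      (nhds (K * W * (2 * Real.sqrt (D * radSq y)))) :=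
    ((continuous_const.mul (continuous_const.mul Real.continuous_sqrt)).tendsto _).mono_left
      nhdsWithin_le_nhds
  have h := ge_of_tendsto hlim (Filter.eventually_of_mem self_mem_nhdsWithin key)
  rw [Real.sqrt_mul hD.le] at h
  exact h.trans_eq (by ring)

/-- Multiplying each `z_j` by a scalar of modulus one leaves the weak norm unchanged. -/
theorem exists_sum_norm_apply_le (hGT : IsGTSpace 𝕜 (StrongDual 𝕜 E))
    (hcot : HasCotype 𝕜 (StrongDual 𝕜 E) 2) :
    ∃ K : ℝ, 0 ≤ K ∧ ∀ (m : ℕ) (y : Fin m → StrongDual 𝕜 E) (z : Fin m → E),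
      ∑ j, ‖y j (z j)‖ ≤ K * Real.sqrt (radSq y) * (weakNorm 𝕜 2 z).toReal := by
  obtain ⟨K, hK0, hK⟩ := exists_norm_sum_apply_le hGT hcot
  refine ⟨K, hK0, fun m y z => ?_⟩
  have ha (t : 𝕜) : ∃ a : 𝕜, ‖a‖ ≤ 1 ∧ a * t = (‖t‖ : 𝕜) := by
    rcases eq_or_ne t 0 with rfl | ht
    · exact ⟨0, by simp, by simp⟩
    · have hn : ‖t‖ ≠ 0 := norm_ne_zero_iff.2 ht
      have hn' : (‖t‖ : 𝕜) ≠ 0 := by simpa using hn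
      refine ⟨starRingEnd 𝕜 t / (‖t‖ : 𝕜), ?_, ?_⟩
      · rw [norm_div, RCLike.norm_conj, RCLike.norm_ofReal, abs_norm, div_self hn]
      · rw [div_mul_eq_mul_div, RCLike.conj_mul, pow_two, mul_div_assoc, div_self hn', mul_one]
  choose a ha1 ha2 using fun j => ha (y j (z j))
  have h := hK m y fun j => a j • z j
  have hsum : ∑ j, y j (a j • z j) = ((∑ j, ‖y j (z j)‖ : ℝ) : 𝕜) := by
    push_cast
    exact Finset.sum_congr rfl fun j _ => by rw [map_smul, smul_eq_mul, ha2]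
  rw [hsum, RCLike.norm_ofReal, abs_of_nonneg (Finset.sum_nonneg fun _ _ => norm_nonneg _)] at h
  refine h.trans (mul_le_mul_of_nonneg_left ?_ (by positivity))
  refine ENNReal.toReal_le_of_le_ofReal ENNReal.toReal_nonneg
    (weakNorm_two_le ENNReal.toReal_nonneg fun φ hφ => ?_)
  refine le_trans ?_ (sum_norm_sq_le_weakNorm z hφ)
  gcongr with j
  rw [map_smul, norm_smul]
  exact mul_le_of_le_one_left (norm_nonneg _) (ha1 j)

end GTSpace

/-! ### Multilinear forms -/

section Forms

variable {𝕜 : Type*} [RCLike 𝕜] {n : ℕ} {E : Fin (n + 1) → Type*}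
  [∀ i, NormedAddCommGroup (E i)] [∀ i, NormedSpace 𝕜 (E i)]

theorem apply_snoc_eq_curryRight (A : ContinuousMultilinearMap 𝕜 E 𝕜) {m : ℕ}
    (x : (i : Fin n) → Fin m → E i.castSucc) (z : Fin m → E (Fin.last n)) (j : Fin m) :
    A (fun i => (Fin.snoc (α := fun i => Fin m → E i) x z : (i : Fin (n + 1)) → Fin m → E i) i j) =
      A.curryRight (fun i => x i j) (z j) := by
  rw [ContinuousMultilinearMap.curryRight_apply]
  congr 1
  funext i
  refine Fin.lastCases ?_ (fun i => ?_) i <;> simp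

theorem sum_fin_le_sum_fin {m N : ℕ} (a : ℕ → ℝ) (ha : ∀ k, 0 ≤ a k) (h0 : ∀ k, m ≤ k → a k = 0) :
    ∑ j : Fin N, a j ≤ ∑ j : Fin m, a j := by
  rw [← Finset.sum_range, ← Finset.sum_range]
  rw [Finset.sum_subset (Finset.range_mono (le_max_right N m)) fun k _ hk =>
    h0 k (not_lt.1 fun h => hk (Finset.mem_range.2 h))]
  exact Finset.sum_le_sum_of_subset_of_nonneg (Finset.range_mono (le_max_left N m))
    fun k _ _ => ha k

theorem IsAbsolutelySumming.isAlmostSumming_curryRight {A : ContinuousMultilinearMap 𝕜 E 𝕜}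
    (hA : IsAbsolutelySumming 1 (fun _ => 2) A) : IsAlmostSumming A.curryRight := by
  obtain ⟨C, hC0, hC⟩ := hA
  refine ⟨C, hC0, fun m x => ?_⟩
  set P : ℝ≥0∞ := ∏ i, weakNorm 𝕜 2 (x i)
  have hP : P ≠ ∞ := ENNReal.prod_ne_top fun i _ => weakNorm_two_ne_top (x i)
  set y : Fin m → StrongDual 𝕜 (E (Fin.last n)) := fun j => A.curryRight fun i => x i j
  have hD : ENNReal.ofReal (C * P.toReal) = C * P := by
    rw [ENNReal.ofReal_mul C.coe_nonneg, ENNReal.ofReal_coe_nnreal, ENNReal.ofReal_toReal hP]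
  have hy (z : Fin m → E (Fin.last n)) : ENNReal.ofReal (∑ j, ‖y j (z j)‖) ≤
      ENNReal.ofReal (C * P.toReal) * weakNorm 𝕜 2 z := by
    have h := hC m (Fin.snoc (α := fun i => Fin m → E i) x z)
    rw [Fin.prod_univ_castSucc, ellNorm_one_eq_sum] at h
    simp only [apply_snoc_eq_curryRight, Fin.snoc_castSucc, Fin.snoc_last] at h
    rw [hD, mul_assoc]
    exact h
  refine iSup_le fun N => ?_
  rw [eLpNorm_radSum_eq, ← hD]
  refine ENNReal.ofReal_le_ofReal (Real.sqrt_le_iff.2 ⟨by positivity, ?_⟩)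
  refine radSq_le_of_forall_sum_le _ (by positivity) fun z => ?_
  -- a family of any length is tested by restricting or extending it by zero to length `m`
  have hy' := hy fun j => extendZero z j
  have hsum : ∑ j : Fin N, ‖extendZero y j (z j)‖ ≤ ∑ j : Fin m, ‖y j (extendZero z j)‖ := by
    have h := sum_fin_le_sum_fin (N := N) (m := m)
      (fun k => ‖extendZero y k (extendZero z k)‖) (fun _ => norm_nonneg _)
      fun k hk => by simp [extendZero, not_lt.2 hk]
    simpa [extendZero] using h
  have hweak : weakNorm 𝕜 2 (fun j : Fin m => extendZero z j) ≤ weakNorm 𝕜 2 z := by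
    refine (weakNorm_two_le ENNReal.toReal_nonneg fun φ hφ => ?_).trans
      ENNReal.ofReal_toReal_le
    refine le_trans ?_ (sum_norm_sq_le_weakNorm z hφ)
    have h := sum_fin_le_sum_fin (N := m) (m := N) (fun k => ‖φ (extendZero z k)‖ ^ 2)
      (fun _ => by positivity) fun k hk => by simp [extendZero, not_lt.2 hk]
    simpa [extendZero] using h
  exact (ENNReal.ofReal_le_ofReal hsum).trans (hy'.trans (mul_le_mul_right hweak _))

theorem IsAlmostSumming.isAbsolutelySumming_of_curryRight {A : ContinuousMultilinearMap 𝕜 E 𝕜}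
    (hGT : IsGTSpace 𝕜 (StrongDual 𝕜 (E (Fin.last n))))
    (hcot : HasCotype 𝕜 (StrongDual 𝕜 (E (Fin.last n))) 2)
    (hA : IsAlmostSumming A.curryRight) : IsAbsolutelySumming 1 (fun _ => 2) A := by
  obtain ⟨C, hC0, hC⟩ := hA
  obtain ⟨K, hK0, hK⟩ := exists_sum_norm_apply_le hGT hcot
  refine ⟨⟨K, hK0⟩ * C + 1, by positivity, fun m x => ?_⟩
  set y : Fin m → StrongDual 𝕜 (E (Fin.last n)) :=
    fun j => A.curryRight fun i => x i.castSucc j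
  set z := x (Fin.last n)
  set P : ℝ≥0∞ := ∏ i : Fin n, weakNorm 𝕜 2 (x i.castSucc)
  have hrad : ENNReal.ofReal (Real.sqrt (radSq y)) ≤ C * P := by
    refine le_trans ?_ (hC m fun i => x i.castSucc)
    refine le_trans (le_of_eq ?_) (le_iSup _ m)
    rw [eLpNorm_radSum_eq]
    congr 3
    funext j
    simp [extendZero, y]
  have hxz (j : Fin m) : A (fun i => x i j) = y j (z j) := by
    rw [← apply_snoc_eq_curryRight A (fun i => x i.castSucc) z]
    congr 1
    funext i
    refine Fin.lastCases ?_ (fun i => ?_) i <;> simp [z]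
  simp only [hxz]
  rw [ellNorm_one_eq_sum, Fin.prod_univ_castSucc]
  calc ENNReal.ofReal (∑ j, ‖y j (z j)‖)
      ≤ ENNReal.ofReal (K * Real.sqrt (radSq y) * (weakNorm 𝕜 2 z).toReal) :=
        ENNReal.ofReal_le_ofReal (hK m y z)
    _ = ENNReal.ofReal K * ENNReal.ofReal (Real.sqrt (radSq y)) * weakNorm 𝕜 2 z := by
        rw [ENNReal.ofReal_mul (by positivity), ENNReal.ofReal_mul hK0,
          ENNReal.ofReal_toReal (weakNorm_two_ne_top z)]
    _ ≤ ENNReal.ofReal K * (C * P) * weakNorm 𝕜 2 z := by gcongr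
    _ = (ENNReal.ofReal K * C) * (P * weakNorm 𝕜 2 z) := by ring
    _ ≤ ((⟨K, hK0⟩ * C + 1 : ℝ≥0) : ℝ≥0∞) * (P * weakNorm 𝕜 2 z) := by
        gcongr
        push_cast
        rw [ENNReal.ofReal_eq_coe_nnreal hK0]
        exact le_self_add

end Forms

end MultilinearSumming

/-- The spaces `E_1, …, E_n` of the mathematical statement are indexed by `Fin (n + 1)` here, so
its `n ≥ 2` reads `1 ≤ n`; the associated mapping with values in the dual of the last space is
`A.curryRight`. -/
theorem mainTheorem11 {𝕜 : Type*} [RCLike 𝕜] {n : ℕ} (hn : 1 ≤ n) {E : Fin (n + 1) → Type*}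
    [∀ i, NormedAddCommGroup (E i)] [∀ i, NormedSpace 𝕜 (E i)] [∀ i, CompleteSpace (E i)]
    (A : ContinuousMultilinearMap 𝕜 E 𝕜) :
    (MultilinearSumming.IsAbsolutelySumming 1 (fun _ => 2) A →
      MultilinearSumming.IsAlmostSumming A.curryRight) ∧
    (MultilinearSumming.IsGTSpace 𝕜 (StrongDual 𝕜 (E (Fin.last n))) →
      MultilinearSumming.HasCotype 𝕜 (StrongDual 𝕜 (E (Fin.last n))) 2 →
      MultilinearSumming.IsAlmostSumming A.curryRight →
      MultilinearSumming.IsAbsolutelySumming 1 (fun _ => 2) A) :=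
  ⟨fun h => h.isAlmostSumming_curryRight,
    fun hGT hcot h => h.isAbsolutelySumming_of_curryRight hGT hcot⟩
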